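/- Let $n\ge 0$ and $T>0$, let $R$ be a linear subspace of $\mathbf C^{2n}=\mathbf C^n\oplus\mathbf C^n$, and let $(\cdot,\cdot)$ denote the standard Hermitian inner products, linear in the first argument. Put $$R^b=\{(x,y)\in\mathbf C^{2n}:(x,-y)\in R^\perp\},\qquad S=\{x\in\mathbf C^n:(x,x)\in R^b\},$$ $$W(R)=\{(x,y,z,u)\in\mathbf C^{4n}:(x,-z)\in R^\perp,\ (y,u)\in R\},\qquad J=\begin{pmatrix}0&-I_n\\ I_n&0\end{pmatrix},\qquad \omega(v,w)=(Jv,w)\ \text{ on } \mathbf C^{2n}.$$ *Maslov-type index.* Put $\mathcal J=\operatorname{diag}(-J,J)$ on $\mathbf C^{4n}=\mathbf C^{2n}\oplus\mathbf C^{2n}$; it gives the symplectic structure $(\mathcal J\cdot,\cdot)=(-\omega)\oplus\omega$. Let $X_1=\ker(\mathcal J-\sqrt{-1}\,I)$ and $X_2=\ker(\mathcal J+\sqrt{-1}\,I)$. The Lagrange subspaces of $\mathbf C^{4n}$ are the graphs $\{x+Ux:x\in X_1\}$ of linear isometries $U$ of $X_1$ onto $X_2$. Let $\gamma$ be a continuous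 path of symplectic matrices on $[0,T]$ and $W$ a Lagrange subspace of $\mathbf C^{4n}$; let $U(t)$ and $U'$ be the isometries whose graphs are $\operatorname{Gr}(\gamma(t))=\{(v,\gamma(t)v):v\in\mathbf C^{2n}\}$ and $W$. The Maslov-type index is $i_W(\gamma)=-\mathrm{sf}\{U'^{-1}U(t);\,0\le t\le T\}$. Here the spectral flow $\mathrm{sf}\{A_t\}$ of a continuous path of unitary operators counts the eigenvalues, with algebraic multiplicity, that pass through $1$ from the lower side to the upper side of the unit circle, minus those that pass in the other direction, the point $1$ itself belonging to the upper side. Precisely: choose $0=s_0\le s_1\le\dots\le s_m=T$ and $\varepsilon_1,\dots,\varepsilon_m\in(0,\pi)$ such that $e^{\sqrt{-1}\varepsilon_k}$ is not an eigenvalue of $A_t$ for $t\in[s_{k-1},s_k]$; then $$\mathrm{sf}\{A_t\}=\sum_{k=1}^m\big(N(A_{s_k},\varepsilon_k)-N(A_{s_{k-1}},\varepsilon_k)\big),$$ where $N(A,\varepsilon)$ is the number of eigenvalues $e^{\sqrt{-1}\theta}$ of $A$ with $0\le\theta<\varepsilon$, counted with algebraic multiplicity. **Theorem 1.2.** Let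 $P\in C([0,T],\mathrm{gl}(n,\mathbf C))$ be a path of selfadjoint matrices, and let $$\gamma(t)=\begin{pmatrix}I&0\\ P(t)&I\end{pmatrix},\qquad t\in[0,T].$$ Then the Maslov-type index $i_{W(R)}(\gamma)$ is well defined, and $$i_{W(R)}(\gamma)=m^+(P(T)|_S)-m^+(P(0)|_S),$$ where $m^+(P|_S)$ denotes the Morse positive index of the Hermitian form $(Px,y)$, $x,y\in S$, that is, the number of positive eigenvalues, counted with multiplicity, of the selfadjoint operator on $S$ that represents it. -/

import Mathlib

open Set

noncomputable section

namespace MaslovIndex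

/-! ### Hilbert direct sums and symplectic forms -/

section Symplectic

variable {E X Y : Type*} [NormedAddCommGroup E] [InnerProductSpace ℂ E]
  [NormedAddCommGroup X] [InnerProductSpace ℂ X]
  [NormedAddCommGroup Y] [InnerProductSpace ℂ Y]

/-- The operator with block form `(A B; C D)` on the Hilbert direct sum `X ⊕ Y`:
`(x, y) ↦ (A x + B y, C x + D y)`. -/
def blockOp (A : X →L[ℂ] X) (B : Y →L[ℂ] X) (C : X →L[ℂ] Y) (D : Y →L[ℂ] Y) :
    WithLp 2 (X × Y) →L[ℂ] WithLp 2 (X × Y) where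
  toFun v := WithLp.toLp 2 (A v.fst + B v.snd, C v.fst + D v.snd)
  map_add' v w := by
    apply WithLp.ofLp_injective
    ext <;> simp <;> abel
  map_smul' c v := by
    apply WithLp.ofLp_injective
    ext <;> simp
  cont := by fun_prop

/-- The graph `{(x, M x)}` of an operator, as a subspace of the Hilbert direct sum. -/
def graph (M : X →L[ℂ] Y) : Submodule ℂ (WithLp 2 (X × Y)) where
  carrier := {v | v.snd = M v.fst}
  add_mem' {v w} hv hw := by
    simp only [mem_ofPred_eq] at hv hw ⊢
    simp [hv, hw]
  zero_mem' := by simp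
  smul_mem' c v hv := by
    simp only [mem_ofPred_eq] at hv ⊢
    simp [hv]

/-- The form `ω(x, y) = (j x, y)`, where `( , )` is linear in its first argument (so that it is
`inner ℂ` with the arguments exchanged). -/
def omega (j : E →L[ℂ] E) (x y : E) : ℂ := inner ℂ y (j x)

/-- `Λ` is a Lagrange subspace: it equals its symplectic complement
`{y | ∀ x ∈ Λ, ω(x, y) = 0}`. -/
def IsLagrange (j : E →L[ℂ] E) (Λ : Submodule ℂ E) : Prop :=
  ∀ y : E, (∀ x ∈ Λ, omega j x y = 0) ↔ y ∈ Λ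

/-- `M` is a linear symplectic map from `(X, ω₁)` to `(Y, ω₂)`. -/
def IsSymplecticMap (j₁ : X →L[ℂ] X) (j₂ : Y →L[ℂ] Y) (M : X →L[ℂ] Y) : Prop :=
  ∀ x y : X, omega j₂ (M x) (M y) = omega j₁ x y

/-- `J` is skew selfadjoint with `J² = -I`. -/
def IsCompatible (J : E →L[ℂ] E) : Prop :=
  (∀ x y : E, inner ℂ (J x) y = -inner ℂ x (J y)) ∧ ∀ x : E, J (J x) = -x

/-- `X₁ = ker (J - √-1 I)`. -/
abbrev plusSpace (J : E →L[ℂ] E) : Submodule ℂ E :=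
  Module.End.eigenspace (J : E →ₗ[ℂ] E) Complex.I

/-- `X₂ = ker (J + √-1 I)`. -/
abbrev minusSpace (J : E →L[ℂ] E) : Submodule ℂ E :=
  Module.End.eigenspace (J : E →ₗ[ℂ] E) (-Complex.I)

/-- The graph `{x + U x | x ∈ X₁}` of an isometry `U` of `X₁` onto `X₂`, as a subspace of
`E = X₁ ⊕ X₂`. -/
def isometryGraph (J : E →L[ℂ] E) (U : plusSpace J ≃ₗᵢ[ℂ] minusSpace J) : Submodule ℂ E :=
  LinearMap.range ((plusSpace J).subtype +
    (minusSpace J).subtype ∘ₗ (U.toLinearEquiv : plusSpace J →ₗ[ℂ] minusSpace J))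

end Symplectic

/-! ### Spectral flow of unitary curves and Morse positive index (finite dimension) -/

section SpectralFlow

variable {V : Type*} [NormedAddCommGroup V] [InnerProductSpace ℂ V] [FiniteDimensional ℂ V]

/-- The number of eigenvalues `exp (iθ)`, `0 ≤ θ < ε`, of a unitary operator, counted with
algebraic multiplicity: the eigenvalues at `1` or on the upper side of `1`, up to angle `ε`. -/
def upperCount (A : V ≃ₗᵢ[ℂ] V) (ε : ℝ) : ℕ :=
  Multiset.card ((LinearMap.charpoly (A.toLinearEquiv : V →ₗ[ℂ] V)).roots.filter
    fun z => 0 ≤ Complex.arg z ∧ Complex.arg z < ε)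

/-- `k` is the spectral flow of the continuous curve of unitary operators `A t`, `a ≤ t ≤ b`,
through a small real interval around `1` that is cooriented from the lower to the upper half
plane: the number of eigenvalues that move from the lower side of `1` to `1` or its upper side,
minus the number that move the other way. The interval `[a, b]` is subdivided so that on the
`i`-th piece no eigenvalue equals `exp (i ε_i)`; on that piece the number of eigenvalues
`exp (iθ)`, `0 ≤ θ < ε_i`, can then change only by passages through `1`. -/
def HasSpectralFlow (A : ℝ → (V ≃ₗᵢ[ℂ] V)) (a b : ℝ) (k : ℤ) : Prop :=
  ContinuousOn (fun t => ((A t : V ≃L[ℂ] V) : V →L[ℂ] V)) (Icc a b) ∧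
  ∃ (m : ℕ) (s ε : ℕ → ℝ), Monotone s ∧ s 0 = a ∧ s m = b ∧
    (∀ i < m, 0 < ε i ∧ ε i < Real.pi ∧ ∀ t ∈ Icc (s i) (s (i + 1)),
      ¬ Module.End.HasEigenvalue ((A t).toLinearEquiv : V →ₗ[ℂ] V)
        (Complex.exp (ε i * Complex.I))) ∧
    k = ∑ i ∈ Finset.range m,
      ((upperCount (A (s (i + 1))) (ε i) : ℤ) - (upperCount (A (s i)) (ε i) : ℤ))

/-- The Morse positive index `m⁺(A)`: the number of eigenvalues in the open right half plane,
counted with algebraic multiplicity. -/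
def morsePos {F : Type*} [AddCommGroup F] [Module ℂ F] [Module.Finite ℂ F] (A : F →ₗ[ℂ] F) : ℕ :=
  Multiset.card (A.charpoly.roots.filter fun z => 0 < z.re)

/-- The operator on the subspace `S` that represents the form `(A x, y)`, `x, y ∈ S`. -/
def restrictForm (A : V →L[ℂ] V) (S : Submodule ℂ V) : S →ₗ[ℂ] S :=
  (S.orthogonalProjectionOnto ∘L A ∘L S.subtypeL : S →L[ℂ] S)

end SpectralFlow

/-! ### Maslov index and Maslov-type index (finite dimension)

In finite dimension every pair of subspaces is a Fredholm pair. -/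

section Maslov

variable {E X Y : Type*} [NormedAddCommGroup E] [InnerProductSpace ℂ E] [FiniteDimensional ℂ E]
  [NormedAddCommGroup X] [InnerProductSpace ℂ X] [FiniteDimensional ℂ X]
  [NormedAddCommGroup Y] [InnerProductSpace ℂ Y] [FiniteDimensional ℂ Y]

/-- `k` is the Maslov index `i(Λ, Λ')` of the continuous curve of pairs of Lagrange subspaces
`Λ t = Gr (U t)`, `Λ' t = Gr (U' t)`, `a ≤ t ≤ b`, for `ω(x, y) = (J x, y)`: it is minus the
spectral flow of `U' t ⁻¹ ∘ U t` through `1`. -/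
def HasMaslovIndex (J : E →L[ℂ] E) (Λ Λ' : ℝ → Submodule ℂ E) (a b : ℝ) (k : ℤ) : Prop :=
  IsCompatible J ∧
  ∃ U U' : ℝ → (plusSpace J ≃ₗᵢ[ℂ] minusSpace J),
    ContinuousOn (fun t => ((U t : plusSpace J ≃L[ℂ] minusSpace J) :
      plusSpace J →L[ℂ] minusSpace J)) (Icc a b) ∧
    ContinuousOn (fun t => ((U' t : plusSpace J ≃L[ℂ] minusSpace J) :
      plusSpace J →L[ℂ] minusSpace J)) (Icc a b) ∧
    (∀ t ∈ Icc a b, Λ t = isometryGraph J (U t) ∧ Λ' t = isometryGraph J (U' t)) ∧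
    HasSpectralFlow (fun t => (U t).trans (U' t).symm) a b (-k)

/-- The operator `diag(-j₁, j₂)`, which gives the symplectic structure `(-ω₁) ⊕ ω₂`. -/
def diffStructure (j₁ : X →L[ℂ] X) (j₂ : Y →L[ℂ] Y) :
    WithLp 2 (X × Y) →L[ℂ] WithLp 2 (X × Y) :=
  blockOp (-j₁) 0 0 j₂

/-- `k` is the Maslov-type index `i_W(M)` of the continuous curve `M t`, `a ≤ t ≤ b`, of linear
symplectic maps from `(X, ω₁)` to `(Y, ω₂)`, with respect to the Lagrange subspace `W` of
`(X ⊕ Y, (-ω₁) ⊕ ω₂)`: the Maslov index of the pair `(Gr (M t), W)`. -/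
def HasMaslovTypeIndex (j₁ : X →L[ℂ] X) (j₂ : Y →L[ℂ] Y) (W : Submodule ℂ (WithLp 2 (X × Y)))
    (M : ℝ → (X →L[ℂ] Y)) (a b : ℝ) (k : ℤ) : Prop :=
  IsLagrange (diffStructure j₁ j₂) W ∧
  ContinuousOn M (Icc a b) ∧
  (∀ t ∈ Icc a b, IsSymplecticMap j₁ j₂ (M t)) ∧
  HasMaslovIndex (diffStructure j₁ j₂) (fun t => graph (M t)) (fun _ => W) a b k

/-- The Maslov-type index `i_W(M)` as an integer. -/
def maslovTypeIndex (j₁ : X →L[ℂ] X) (j₂ : Y →L[ℂ] Y) (W : Submodule ℂ (WithLp 2 (X × Y)))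
    (M : ℝ → (X →L[ℂ] Y)) (a b : ℝ) : ℤ :=
  Classical.epsilon fun k => HasMaslovTypeIndex j₁ j₂ W M a b k

end Maslov

/-! ### The boundary conditions and the path in `Sp(2n, ℂ)` -/

section Boundary

/-- `ℂⁿ` with its standard Hermitian inner product. -/
abbrev Cn (n : ℕ) : Type := EuclideanSpace ℂ (Fin n)

/-- `ℂ²ⁿ = ℂⁿ ⊕ ℂⁿ`, whose vectors are pairs `(x, y)`. -/
abbrev C2n (n : ℕ) : Type := WithLp 2 (Cn n × Cn n)

variable {n : ℕ}

/-- A `2n × 2n` matrix in block form, acting on `ℂ²ⁿ`. -/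
def blockMatrix (A B C D : Matrix (Fin n) (Fin n) ℂ) : C2n n →L[ℂ] C2n n :=
  blockOp (Matrix.toEuclideanCLM (𝕜 := ℂ) A) (Matrix.toEuclideanCLM (𝕜 := ℂ) B)
    (Matrix.toEuclideanCLM (𝕜 := ℂ) C) (Matrix.toEuclideanCLM (𝕜 := ℂ) D)

/-- `J = (0 -I; I 0)`. -/
def stdJ (n : ℕ) : C2n n →L[ℂ] C2n n := blockMatrix 0 (-1) 1 0

/-- `R^b = {(x, y) | (x, -y) ∈ R^⊥}`. -/
def Rb (R : Submodule ℂ (C2n n)) : Submodule ℂ (C2n n) where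
  carrier := {v | WithLp.toLp 2 (v.fst, -v.snd) ∈ Rᗮ}
  add_mem' {v w} hv hw := by
    have h := Rᗮ.add_mem hv hw
    rw [← WithLp.toLp_add, Prod.mk_add_mk, ← neg_add] at h
    exact h
  zero_mem' := by
    have h := Rᗮ.zero_mem
    simp only [mem_ofPred_eq, WithLp.zero_fst, WithLp.zero_snd, neg_zero]
    exact h
  smul_mem' c v hv := by
    have h := Rᗮ.smul_mem c hv
    rw [← WithLp.toLp_smul, Prod.smul_mk, smul_neg] at h
    exact h

/-- `W(R) = {(x, y, z, u) | (x, -z) ∈ R^⊥, (y, u) ∈ R}`, a subspace of `ℂ⁴ⁿ = ℂ²ⁿ ⊕ ℂ²ⁿ`. -/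
def WR (R : Submodule ℂ (C2n n)) : Submodule ℂ (WithLp 2 (C2n n × C2n n)) where
  carrier := {w | WithLp.toLp 2 (w.fst.fst, -w.snd.fst) ∈ Rᗮ ∧
    WithLp.toLp 2 (w.fst.snd, w.snd.snd) ∈ R}
  add_mem' {v w} hv hw := by
    have h₁ := Rᗮ.add_mem hv.1 hw.1
    have h₂ := R.add_mem hv.2 hw.2
    rw [← WithLp.toLp_add, Prod.mk_add_mk] at h₁ h₂
    rw [← neg_add] at h₁
    exact ⟨h₁, h₂⟩
  zero_mem' := by
    have h₁ := Rᗮ.zero_mem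
    have h₂ := R.zero_mem
    simp only [mem_ofPred_eq, WithLp.zero_fst, WithLp.zero_snd, neg_zero]
    exact ⟨h₁, h₂⟩
  smul_mem' c v hv := by
    have h₁ := Rᗮ.smul_mem c hv.1
    have h₂ := R.smul_mem c hv.2
    rw [← WithLp.toLp_smul, Prod.smul_mk] at h₁ h₂
    rw [smul_neg] at h₁
    exact ⟨h₁, h₂⟩

/-- `S = {x ∈ ℂⁿ | (x, x) ∈ R^b}`. -/
def diagSpace (R : Submodule ℂ (C2n n)) : Submodule ℂ (Cn n) where
  carrier := {x | WithLp.toLp 2 (x, x) ∈ Rb R}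
  add_mem' {v w} hv hw := by
    have h := (Rb R).add_mem hv hw
    rw [← WithLp.toLp_add, Prod.mk_add_mk] at h
    exact h
  zero_mem' := by
    have h := (Rb R).zero_mem
    exact h
  smul_mem' c v hv := by
    have h := (Rb R).smul_mem c hv
    rw [← WithLp.toLp_smul, Prod.smul_mk] at h
    exact h

/-- The Morse positive index `m⁺(P|_S)` of the restriction to `S` of the Hermitian form
`(P x, y)`. -/
def morsePosOn (P : Matrix (Fin n) (Fin n) ℂ) (S : Submodule ℂ (Cn n)) : ℕ :=
  morsePos (restrictForm (Matrix.toEuclideanCLM (𝕜 := ℂ) P) S)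

/-- The path `γ(t) = (I 0; P(t) I)`. -/
def shearPath (P : ℝ → Matrix (Fin n) (Fin n) ℂ) (t : ℝ) : C2n n →L[ℂ] C2n n :=
  blockMatrix 1 0 (P t) 1

end Boundary

end MaslovIndex

end

open Filter Topology

noncomputable section

namespace MaslovIndex

/-! In the coordinates p = (x, -z), q = (y, u) on ℂ⁴ⁿ, the space X₁ is q = ip, X₂ is q = -ip, and
W(R) is Rᗮ ⊕ R. Hence U' becomes the reflection that fixes Rᗮ and negates R. The graph of γ(t)
consists of p = (x, -x), q = (y, Px + y), and there (p, q) = -(Px, x) is real.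

Fix ε such that exp(iε) is not an eigenvalue of A = U'⁻¹U. On an eigenvector of angle θ, the form
Re(e^{-iε/2}(Av, v)) - cos(ε/2)‖v‖² has the sign of sin(θ/2) sin((ε - θ)/2). It is therefore
nonnegative on a space of dimension `upperCount A ε` and negative on one of the complementary
dimension (`exists_arc_splitting`). In graph coordinates it is a positive multiple of `arcForm` with
τ = tan(ε/2) (`re_inner_eq_arcForm`). Completing a square in the Rᗮ-part of q eliminates y and
leaves `penaltyForm`, a form on ℂⁿ; adding z ∈ S to x costs τ(Pz, z) (`penaltyForm_identity`). A
dimension count (`exists_definite_subspaces`) then shows that `penaltyForm` is nondegenerate with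
negative index `upperCount A ε` + m⁺(P|_S) - d, where d = dim {y | (y, y) ∈ R} does not depend on t.

The index of a nondegenerate form is locally constant (`eq_of_definite_subspaces`), so `upperCount`
+ m⁺ agrees at the two ends of each piece of a subdivision. The spectral flow telescopes to
m⁺(P(0)|_S) - m⁺(P(T)|_S), and the Maslov-type index is its negative. The computation works for
every subdivision and every choice of isometries, which gives uniqueness. Existence rests on
`exists_eq_isometryGraph`, `continuousOn_of_graph` and `exists_partition`. -/

/-! ### Orthonormal eigenbases and eigenvalue counts. -/

theorem norm_sq_eq_sum_repr {V ι : Type*} [NormedAddCommGroup V] [InnerProductSpace ℂ V]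
    [Fintype ι] (b : OrthonormalBasis ι ℂ V) (v : V) : ‖v‖ ^ 2 = ∑ i, ‖b.repr v i‖ ^ 2 := by
  rw [← b.repr.norm_map, EuclideanSpace.norm_sq_eq]

theorem inner_apply_eq_sum {V ι : Type*} [NormedAddCommGroup V] [InnerProductSpace ℂ V]
    [Fintype ι] (b : OrthonormalBasis ι ℂ V)
    (A : V →ₗ[ℂ] V) (μ : ι → ℂ) (h : ∀ i, A (b i) = μ i • b i) (v : V) :
    inner ℂ v (A v) = ∑ i, μ i * (‖b.repr v i‖ ^ 2 : ℝ) := by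
  classical
  have hA : ∀ i, b.repr (A v) i = μ i * b.repr v i := by
    intro i
    have hAv : A v = ∑ j, (b.repr v j * μ j) • b j := by
      conv_lhs => rw [← b.sum_repr v]
      simp only [map_sum, map_smul, h, smul_smul]
    rw [b.repr_apply_apply (A v), hAv, inner_sum]
    simp only [inner_smul_right, b.inner_eq_ite, mul_ite, mul_one, mul_zero, Finset.sum_ite_eq,
      Finset.mem_univ, if_true]
    exact mul_comm _ _
  rw [← b.repr.inner_map_map, PiLp.inner_apply]
  refine Finset.sum_congr rfl fun i _ => ?_
  rw [hA, RCLike.inner_apply, mul_assoc, RCLike.mul_conj]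
  norm_cast

section Spectral

variable {V : Type*} [NormedAddCommGroup V] [InnerProductSpace ℂ V] [FiniteDimensional ℂ V]

theorem charpoly_roots_of_eigenbasis {ι : Type*} [Fintype ι] [DecidableEq ι]
    (b : Module.Basis ι ℂ V) (A : V →ₗ[ℂ] V) (μ : ι → ℂ) (h : ∀ i, A (b i) = μ i • b i) :
    A.charpoly.roots = Finset.univ.val.map μ := by
  have hM : LinearMap.toMatrix b b A = Matrix.diagonal μ := by
    ext i j
    rw [LinearMap.toMatrix_apply, h, map_smul, b.repr_self, Matrix.diagonal_apply]
    simp only [Finsupp.smul_apply, Finsupp.single_apply, smul_eq_mul, mul_ite, mul_one, mul_zero]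
    by_cases hij : i = j
    · simp [hij]
    · simp [hij, Ne.symm hij]
  rw [← LinearMap.charpoly_toMatrix A b, hM, Matrix.charpoly_diagonal]
  have hprod : ∏ i, (Polynomial.X - Polynomial.C (μ i)) =
      ((Finset.univ.val.map μ).map fun a => Polynomial.X - Polynomial.C a).prod := by
    rw [Multiset.map_map]
    rfl
  rw [hprod, Polynomial.roots_multiset_prod_X_sub_C]

/-- The eigenvalues that satisfy a predicate are counted by the dimension of a sum of
eigenspaces, which has a complement of the same kind. -/
theorem exists_spectral_splitting {ι : Type*} [Fintype ι] (b : OrthonormalBasis ι ℂ V)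
    (A : V →ₗ[ℂ] V) (μ : ι → ℂ) (h : ∀ i, A (b i) = μ i • b i) (p : ℂ → Prop)
    [DecidablePred p] :
    ∃ V₁ V₂ : Submodule ℂ V,
      Module.finrank ℂ V₁ = Multiset.card (A.charpoly.roots.filter p) ∧
      Module.finrank ℂ V₁ + Module.finrank ℂ V₂ = Module.finrank ℂ V ∧
      (∀ v ∈ V₁, ∀ i, b.repr v i ≠ 0 → p (μ i)) ∧
      (∀ v ∈ V₂, ∀ i, b.repr v i ≠ 0 → ¬ p (μ i)) := by
  classical
  have key : ∀ q : ι → Prop, ∃ W : Submodule ℂ V,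
      Module.finrank ℂ W = (Finset.univ.filter q).card ∧
      ∀ v ∈ W, ∀ i, b.repr v i ≠ 0 → q i := by
    intro q
    refine ⟨Submodule.span ℂ (range fun i : {i // q i} => b i), ?_, ?_⟩
    · have hli : LinearIndependent ℂ fun i : {i // q i} => b i :=
        b.orthonormal.linearIndependent.comp _ Subtype.val_injective
      rw [finrank_span_eq_card hli, Fintype.card_subtype]
    · intro v hv i hi
      by_contra hq
      apply hi
      rw [b.repr_apply_apply]
      clear hi
      induction hv using Submodule.span_induction with
      | mem x hx =>
        obtain ⟨j, rfl⟩ := hx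
        exact b.orthonormal.2 (fun hij => hq (hij ▸ j.2))
      | zero => simp
      | add x y _ _ hx hy =>
        rw [inner_add_right, hx, hy, add_zero]
      | smul c x _ hx => rw [inner_smul_right, hx, mul_zero]
  obtain ⟨V₁, h₁, h₁'⟩ := key fun i => p (μ i)
  obtain ⟨V₂, h₂, h₂'⟩ := key fun i => ¬ p (μ i)
  refine ⟨V₁, V₂, ?_, ?_, h₁', h₂'⟩
  · rw [h₁, charpoly_roots_of_eigenbasis b.toBasis A μ (by simpa using h), Multiset.filter_map,
      Multiset.card_map, Finset.card_def, Finset.filter_val]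
    congr!
  · rw [h₁, h₂, Finset.card_filter_add_card_filter_not, Module.finrank_eq_card_basis b.toBasis]
    rfl

/-- A unitary operator with an eigenvalue-free point `μ` on the unit circle is diagonalized
through its Cayley transform. -/
theorem exists_orthonormal_eigenbasis (A : V ≃ₗᵢ[ℂ] V) (μ : ℂ) (hμ : ‖μ‖ = 1)
    (hA : ¬ Module.End.HasEigenvalue (A.toLinearEquiv : V →ₗ[ℂ] V) μ) :
    ∃ (b : OrthonormalBasis (Fin (Module.finrank ℂ V)) ℂ V) (ν : Fin (Module.finrank ℂ V) → ℂ),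
      ∀ i, A (b i) = ν i • b i := by
  have hker : LinearMap.ker (μ • LinearMap.id - (A.toLinearEquiv : V →ₗ[ℂ] V)) = ⊥ := by
    rw [LinearMap.ker_eq_bot']
    intro v hv
    by_contra hne
    refine hA (Module.End.hasEigenvalue_of_hasEigenvector (x := v) ⟨?_, hne⟩)
    rw [Module.End.mem_eigenspace_iff]
    exact (sub_eq_zero.1 hv).symm
  set D := LinearEquiv.ofInjectiveEndo _ (LinearMap.ker_eq_bot.1 hker) with hD
  have hDa : ∀ a, D a = μ • a - A a := fun a => rfl
  have hμμ : (starRingEnd ℂ) μ * μ = 1 := by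
    rw [mul_comm, Complex.mul_conj, Complex.normSq_eq_norm_sq, hμ]; norm_num
  -- The Cayley transform i(μ + A)(μ - A)⁻¹ is selfadjoint because |μ| = 1. Solving for A, an
  -- eigenvalue l of it comes from the eigenvalue μ(l - i)/(l + i) of A.
  set H : V →ₗ[ℂ] V := (Complex.I • (μ • LinearMap.id + (A.toLinearEquiv : V →ₗ[ℂ] V))) ∘ₗ
    (D.symm : V →ₗ[ℂ] V) with hH
  have hHD : ∀ a, H (D a) = Complex.I • (μ • a + A a) := by
    intro a; simp [hH]
  have hsym : H.IsSymmetric := by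
    intro u v
    obtain ⟨a, rfl⟩ := D.surjective u
    obtain ⟨c, rfl⟩ := D.surjective v
    rw [hHD, hHD, hDa, hDa]
    simp only [inner_smul_left, inner_smul_right, inner_add_left, inner_add_right, inner_sub_left,
      inner_sub_right, LinearIsometryEquiv.inner_map_map, Complex.conj_I]
    linear_combination (-2 * Complex.I * inner ℂ a c) * hμμ
  refine ⟨hsym.eigenvectorBasis rfl, fun i =>
    let l : ℂ := (hsym.eigenvalues rfl i : ℝ)
    μ * (l - Complex.I) / (l + Complex.I), fun i => ?_⟩
  have he := hsym.apply_eigenvectorBasis rfl i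
  set e := hsym.eigenvectorBasis rfl i
  set l := hsym.eigenvalues rfl i
  obtain ⟨a, ha⟩ := D.surjective e
  have hl : (l : ℂ) + Complex.I ≠ 0 := by
    intro h0
    have := congrArg Complex.im h0
    simp at this
  rw [← ha, hHD, hDa] at he
  have hAa : A a = (μ * (l - Complex.I) / (l + Complex.I)) • a := by
    have h1 : ((l : ℂ) + Complex.I) • A a = (μ * (l - Complex.I)) • a := by
      have he' : Complex.I • (μ • a + A a) = (l : ℂ) • (μ • a - A a) := he
      rw [smul_add, smul_sub, smul_smul, smul_smul] at he'
      rw [add_smul, mul_sub, sub_smul, mul_comm μ, mul_comm μ]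
      rw [← sub_eq_zero] at he' ⊢
      rw [← he']
      abel
    rw [div_eq_inv_mul, mul_smul, ← h1, smul_smul, inv_mul_cancel₀ hl, one_smul]
  show A e = _ • e
  rw [← ha, hDa, map_sub, map_smul, hAa, map_smul, hAa, smul_sub, smul_comm μ]

end Spectral

theorem re_inner_self_eq {F : Type*} [NormedAddCommGroup F] [InnerProductSpace ℂ F] (x : F) : (inner ℂ x x).re = ‖x‖ ^ 2 := by
  rw [inner_self_eq_norm_sq_to_K]; norm_cast

theorem re_inner_comm {F : Type*} [NormedAddCommGroup F] [InnerProductSpace ℂ F]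
    (x y : F) : (inner ℂ x y).re = (inner ℂ y x).re := by
  rw [← inner_conj_symm, Complex.conj_re]

theorem im_inner_comm {F : Type*} [NormedAddCommGroup F] [InnerProductSpace ℂ F]
    (x y : F) : (inner ℂ x y).im = -(inner ℂ y x).im := by
  rw [← inner_conj_symm, Complex.conj_im]

/-! ### The reflection in Rᗮ and the arc form. -/

section Quadratic

variable {F : Type*} [NormedAddCommGroup F] [InnerProductSpace ℂ F] (R : Submodule ℂ F)
  [R.HasOrthogonalProjection]

/-- The form that compares the Lagrange subspaces `Rᗮ ⊕ R` and its rotate, evaluated at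
`(p, q)`. -/
def arcForm (τ : ℝ) (p q : F) : ℝ :=
  τ * ((inner ℂ (Rᗮ.starProjection p) (Rᗮ.starProjection q)).re -
    (inner ℂ (R.starProjection p) (R.starProjection q)).re) -
  (‖R.starProjection p‖ ^ 2 + ‖Rᗮ.starProjection q‖ ^ 2)

theorem inner_proj_perp (x y : F) :
    inner ℂ (R.starProjection x) (Rᗮ.starProjection y) = 0 :=
  R.inner_right_of_mem_orthogonal (R.starProjection_apply_mem x) (Rᗮ.starProjection_apply_mem y)

theorem inner_perp_proj (x y : F) :
    inner ℂ (Rᗮ.starProjection x) (R.starProjection y) = 0 :=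
  R.inner_left_of_mem_orthogonal (R.starProjection_apply_mem y) (Rᗮ.starProjection_apply_mem x)

theorem inner_eq_proj_add_perp (x y : F) :
    inner ℂ x y = inner ℂ (R.starProjection x) (R.starProjection y) +
      inner ℂ (Rᗮ.starProjection x) (Rᗮ.starProjection y) := by
  conv_lhs => rw [← R.starProjection_add_starProjection_orthogonal x,
    ← R.starProjection_add_starProjection_orthogonal y]
  rw [inner_add_left, inner_add_right, inner_add_right, inner_proj_perp, inner_perp_proj]
  ring

/-- Since Im (p, q) = 0, the norm of p - iq has no cross term. The squares of the Rᗮ-part of p and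
the R-part of q then cancel, and the other two double. -/
theorem re_reflection_form (p q : F) (hpq : (inner ℂ p q).im = 0) (c s : ℝ) :
    ((c - s * Complex.I) * inner ℂ (Rᗮ.starProjection (p - Complex.I • q) -
      R.starProjection (p - Complex.I • q)) (p + Complex.I • q)).re -
      c * ‖p - Complex.I • q‖ ^ 2 =
    2 * (s * ((inner ℂ (Rᗮ.starProjection p) (Rᗮ.starProjection q)).re -
      (inner ℂ (R.starProjection p) (R.starProjection q)).re) -
      c * (‖R.starProjection p‖ ^ 2 + ‖Rᗮ.starProjection q‖ ^ 2)) := by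
  have hR : R.starProjection (Rᗮ.starProjection (p - Complex.I • q) -
      R.starProjection (p - Complex.I • q)) = - R.starProjection (p - Complex.I • q) := by
    rw [map_sub, R.starProjection_eq_self_iff.2 (R.starProjection_apply_mem _),
      (R.starProjection_apply_eq_zero_iff).2 (Rᗮ.starProjection_apply_mem _), zero_sub]
  have hR' : Rᗮ.starProjection (Rᗮ.starProjection (p - Complex.I • q) -
      R.starProjection (p - Complex.I • q)) = Rᗮ.starProjection (p - Complex.I • q) := by
    rw [map_sub, Rᗮ.starProjection_eq_self_iff.2 (Rᗮ.starProjection_apply_mem _),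
      (Rᗮ.starProjection_apply_eq_zero_iff).2
        (R.le_orthogonal_orthogonal (R.starProjection_apply_mem _)), sub_zero]
  rw [inner_eq_proj_add_perp R, hR, hR', ← re_inner_self_eq (p - Complex.I • q),
    inner_eq_proj_add_perp R (p - Complex.I • q)]
  rw [inner_eq_proj_add_perp R] at hpq
  clear hR hR'
  simp only [map_sub, map_add, map_smul, inner_neg_left, ← re_inner_self_eq]
  generalize R.starProjection p = p₂ at *
  generalize R.starProjection q = q₂ at *
  generalize Rᗮ.starProjection p = p₁ at *
  generalize Rᗮ.starProjection q = q₁ at *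
  simp only [inner_sub_left, inner_sub_right, inner_add_right, inner_smul_left, inner_smul_right]
  simp only [inner_self_eq_norm_sq_to_K]
  simp [← Complex.ofReal_pow] at hpq ⊢
  have e₁ : (inner ℂ q₁ p₁).re = (inner ℂ p₁ q₁).re := re_inner_comm _ _
  have e₂ : (inner ℂ q₂ p₂).re = (inner ℂ p₂ q₂).re := re_inner_comm _ _
  have e₃ : (inner ℂ q₁ p₁).im = -(inner ℂ p₁ q₁).im := im_inner_comm _ _
  have e₄ : (inner ℂ q₂ p₂).im = -(inner ℂ p₂ q₂).im := im_inner_comm _ _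
  rw [e₁, e₂, e₃, e₄]
  linear_combination (-2 * c) * hpq

end Quadratic

/-! ### Reduction of the arc form to a form on ℂⁿ. -/

section Comparison

variable {n : ℕ} (R : Submodule ℂ (C2n n)) (P : Cn n →L[ℂ] Cn n)

/-- The embedding `x ↦ (x, -x)`. -/
def antidiag (n : ℕ) : Cn n →L[ℂ] C2n n where
  toFun x := WithLp.toLp 2 (x, -x)
  map_add' x y := by apply WithLp.ofLp_injective; ext <;> simp; abel
  map_smul' c x := by apply WithLp.ofLp_injective; ext <;> simp
  cont := by fun_prop

/-- The map `(x, y) ↦ (y, P x + y)`. -/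
def momentum : C2n n →ₗ[ℂ] C2n n where
  toFun v := WithLp.toLp 2 (v.snd, P v.fst + v.snd)
  map_add' x y := by apply WithLp.ofLp_injective; ext <;> simp; abel
  map_smul' c x := by apply WithLp.ofLp_injective; ext <;> simp

/-- The Hermitian form `-(P x, x)`, with the condition `(x, -x) ∈ Rᗮ` relaxed to a penalty. -/
def penaltyForm (τ : ℝ) (x : Cn n) : ℝ :=
  -(inner ℂ x (P x)).re - τ * ‖Rᗮ.starProjection (antidiag n x)‖ ^ 2 +
    τ⁻¹ * ‖R.starProjection (antidiag n x)‖ ^ 2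

theorem mem_diagSpace {x : Cn n} : x ∈ diagSpace R ↔ antidiag n x ∈ Rᗮ := Iff.rfl

theorem inner_antidiag_momentum (x : Cn n) (v : C2n n) :
    inner ℂ (antidiag n x) (momentum P v) = -inner ℂ x (P v.fst) := by
  simp [antidiag, momentum, WithLp.prod_inner_apply, inner_add_right]

theorem antidiag_injective {x : Cn n} (h : antidiag n x = 0) : x = 0 :=
  congrArg WithLp.fst h

variable {P}

/-- Completing the square in the Rᗮ-part of q = `momentum P v`. What remains involves q only through
its products with (x, -x) and (z, -z), where x = `v.fst`, and these products do not depend on y =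
`v.snd`. As (z, -z) lies in Rᗮ, it enters the square but not the R-penalty. -/
theorem penaltyForm_identity (hP : (P : Cn n →ₗ[ℂ] Cn n).IsSymmetric) {τ : ℝ} (hτ : 0 < τ)
    (v : C2n n) {z : Cn n} (hz : z ∈ diagSpace R) :
    -(τ * penaltyForm R P τ (v.fst + z)) =
      arcForm R τ (antidiag n v.fst) (momentum P v) +
      ‖Rᗮ.starProjection (momentum P v - (τ : ℂ) • antidiag n v.fst - (τ : ℂ) • antidiag n z)‖ ^ 2 +
      τ * (inner ℂ z (P z)).re := by
  have hz₂ : R.starProjection (antidiag n z) = 0 :=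
    R.starProjection_apply_eq_zero_iff.2 ((mem_diagSpace R).1 hz)
  have h₁ := congrArg Complex.re (inner_antidiag_momentum P v.fst v)
  have h₂ := congrArg Complex.re (inner_antidiag_momentum P z v)
  rw [inner_eq_proj_add_perp R] at h₁ h₂
  have h₃ : (inner ℂ v.fst (P z)).re = (inner ℂ z (P v.fst)).re := by
    have h := hP v.fst z
    simp only [ContinuousLinearMap.coe_coe] at h
    rw [← h, ← inner_conj_symm, Complex.conj_re]
  unfold penaltyForm arcForm
  simp only [map_add, map_sub, map_smul, hz₂, add_zero] at h₁ h₂ ⊢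
  simp only [← re_inner_self_eq]
  generalize R.starProjection (antidiag n v.fst) = p₂ at *
  generalize R.starProjection (momentum P v) = q₂ at *
  generalize Rᗮ.starProjection (antidiag n v.fst) = p₁ at *
  generalize Rᗮ.starProjection (momentum P v) = q₁ at *
  generalize Rᗮ.starProjection (antidiag n z) = z₁ at *
  simp only [inner_sub_left, inner_sub_right, inner_add_right, inner_add_left, inner_smul_left,
    inner_smul_right]
  simp only [inner_self_eq_norm_sq_to_K]
  simp [← Complex.ofReal_pow, -WithLp.prod_inner_apply] at h₁ h₂ ⊢
  have hτ' : τ * τ⁻¹ = 1 := mul_inv_cancel₀ hτ.ne'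
  have e₁ : (inner ℂ q₁ p₁).re = (inner ℂ p₁ q₁).re := re_inner_comm _ _
  have e₂ : (inner ℂ q₁ z₁).re = (inner ℂ z₁ q₁).re := re_inner_comm _ _
  rw [h₃, e₁, e₂]
  linear_combination (-‖p₂‖ ^ 2) * hτ' + τ * h₁ + 2 * τ * h₂

end Comparison

/-! ### Dimension count for the negative index of the penalty form. -/

section Counting

variable {n : ℕ} (R : Submodule ℂ (C2n n))

/-- The diagonal embedding `x ↦ (x, x)`. -/
def diagMap (n : ℕ) : Cn n →ₗ[ℂ] C2n n where
  toFun x := WithLp.toLp 2 (x, x)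
  map_add' x y := by apply WithLp.ofLp_injective; ext <;> simp
  map_smul' c x := by apply WithLp.ofLp_injective; ext <;> simp

theorem finrank_Cn : Module.finrank ℂ (Cn n) = n := by simp

theorem finrank_C2n : Module.finrank ℂ (C2n n) = n + n := by
  rw [LinearEquiv.finrank_eq (WithLp.linearEquiv 2 ℂ (Cn n × Cn n)), Module.finrank_prod,
    finrank_Cn]

/-- The dimension formula for `{y | (y, y) ∈ R}` and `S`. -/
theorem finrank_comap_diagMap :
    n + Module.finrank ℂ (R.comap (diagMap n)) =
      Module.finrank ℂ R + Module.finrank ℂ (diagSpace R) := by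
  -- Rank-nullity for (a, b) ↦ b - a on R: the kernel consists of the pairs (y, y) in R, and the
  -- orthogonal complement of the range is S.
  let f : R →ₗ[ℂ] Cn n :=
    (WithLp.sndₗ 2 ℂ (Cn n) (Cn n) - WithLp.fstₗ 2 ℂ (Cn n) (Cn n)) ∘ₗ R.subtype
  have hf : ∀ r : R, f r = (r : C2n n).snd - (r : C2n n).fst := fun r => rfl
  have hker : Module.finrank ℂ (LinearMap.ker f) = Module.finrank ℂ (R.comap (diagMap n)) := by
    refine LinearEquiv.finrank_eq (LinearEquiv.ofBijective
      ((diagMap n).restrict (p := R.comap (diagMap n)) (q := R) (fun x hx => hx) |>.codRestrict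
        (LinearMap.ker f) ?_) ⟨?_, ?_⟩).symm
    · intro x
      rw [LinearMap.mem_ker, hf]
      exact sub_self _
    · intro x y hxy
      apply Subtype.ext
      exact congrArg (fun w : LinearMap.ker f => ((w : R) : C2n n).fst) hxy
    · intro w
      have hw : ((w : R) : C2n n).snd = ((w : R) : C2n n).fst := sub_eq_zero.1 w.2
      have hd : diagMap n ((w : R) : C2n n).fst = ((w : R) : C2n n) := by
        apply WithLp.ofLp_injective
        exact Prod.ext rfl hw.symm
      refine ⟨⟨((w : R) : C2n n).fst, ?_⟩, ?_⟩
      · rw [Submodule.mem_comap, hd]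
        exact (w : R).2
      · apply Subtype.ext
        apply Subtype.ext
        exact hd
  have hrange : (LinearMap.range f)ᗮ = diagSpace R := by
    ext x
    rw [mem_diagSpace, Submodule.mem_orthogonal, Submodule.mem_orthogonal]
    have h : ∀ r : R, inner ℂ (r : C2n n) (antidiag n x) = -inner ℂ (f r) x := by
      intro r
      simp [hf, antidiag, WithLp.prod_inner_apply]
      ring
    constructor
    · intro hx r hr
      rw [h ⟨r, hr⟩, hx _ ⟨_, rfl⟩, neg_zero]
    · rintro hx _ ⟨r, rfl⟩
      rw [← neg_eq_zero, ← h r, hx r r.2]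
  have h₁ := (LinearMap.range f).finrank_add_finrank_orthogonal
  have h₂ := LinearMap.finrank_range_add_finrank_ker f
  rw [hrange, finrank_Cn] at h₁
  omega

variable {P : Cn n →L[ℂ] Cn n}

/-- A splitting of `ℂ²ⁿ` with respect to the arc form and a splitting of `S` with respect to
`(P x, x)` combine to subspaces on which the penalty form is definite. -/
theorem exists_definite_subspaces (hP : (P : Cn n →ₗ[ℂ] Cn n).IsSymmetric) {τ : ℝ} (hτ : 0 < τ)
    (Z Z' : Submodule ℂ (C2n n)) (hZZ' : Module.finrank ℂ Z + Module.finrank ℂ Z' = n + n)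
    (hZ : ∀ v ∈ Z, 0 ≤ arcForm R τ (antidiag n v.fst) (momentum P v))
    (hZ₀ : ∀ v ∈ Z, arcForm R τ (antidiag n v.fst) (momentum P v) = 0 →
      antidiag n v.fst ∈ Rᗮ ∧ momentum P v ∈ R)
    (hZ' : ∀ v ∈ Z', v ≠ 0 → arcForm R τ (antidiag n v.fst) (momentum P v) < 0)
    (S₁ S₂ : Submodule ℂ (diagSpace R))
    (hS : Module.finrank ℂ S₁ + Module.finrank ℂ S₂ = Module.finrank ℂ (diagSpace R))
    (hS₁ : ∀ z ∈ S₁, z ≠ 0 → 0 < (inner ℂ (z : Cn n) (P z)).re)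
    (hS₂ : ∀ z ∈ S₂, (inner ℂ (z : Cn n) (P z)).re ≤ 0) :
    ∃ V₁ V₂ : Submodule ℂ (Cn n),
      (∀ x ∈ V₁, x ≠ 0 → penaltyForm R P τ x < 0) ∧
      (∀ x ∈ V₂, x ≠ 0 → 0 < penaltyForm R P τ x) ∧
      Module.finrank ℂ Z + Module.finrank ℂ S₁ ≤
        Module.finrank ℂ V₁ + Module.finrank ℂ (R.comap (diagMap n)) ∧
      n + Module.finrank ℂ (R.comap (diagMap n)) ≤
        Module.finrank ℂ V₂ + (Module.finrank ℂ Z + Module.finrank ℂ S₁) := by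
  have hself : ∀ z : diagSpace R, Rᗮ.starProjection (antidiag n z) = antidiag n (z : Cn n) :=
    fun z => Rᗮ.starProjection_eq_self_iff.2 ((mem_diagSpace R).1 z.2)
  have hτc : (τ : ℂ) ≠ 0 := Complex.ofReal_ne_zero.2 hτ.ne'
  have hS₁' : ∀ z ∈ S₁, 0 ≤ (inner ℂ (z : Cn n) (P z)).re := by
    intro z hz
    by_cases h0 : z = 0
    · simp [h0]
    · exact (hS₁ z hz h0).le
  let f : C2n n →ₗ[ℂ] Cn n := WithLp.fstₗ 2 ℂ (Cn n) (Cn n)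
  -- the negative part
  let Φ : (Z × S₁) →ₗ[ℂ] Cn n := (f ∘ₗ Z.subtype).coprod ((diagSpace R).subtype ∘ₗ S₁.subtype)
  have hΦ : ∀ w : Z × S₁, Φ w = (w.1 : C2n n).fst + ((w.2 : diagSpace R) : Cn n) := fun w => rfl
  -- All three terms on the right of `penaltyForm_identity` are nonnegative on Z × S₁, so a
  -- nonnegative penalty form makes each of them vanish.
  have hneg : ∀ w : Z × S₁, 0 ≤ penaltyForm R P τ (Φ w) →
      (w.2 = 0 ∧ (w.1 : C2n n).fst = 0 ∧ momentum P w.1 ∈ R) := by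
    rintro ⟨v, z⟩ hw
    have hid := penaltyForm_identity R hP hτ (v : C2n n) (z : diagSpace R).2
    rw [hΦ] at hw
    have h₁ := hZ v v.2
    have h₂ := hS₁' z z.2
    have h₃ := mul_nonneg hτ.le hw
    have h₄ := mul_nonneg hτ.le h₂
    have h₅ := sq_nonneg ‖Rᗮ.starProjection (momentum P v - (τ : ℂ) • antidiag n (v : C2n n).fst -
      (τ : ℂ) • antidiag n (z : diagSpace R))‖
    have hz : z = 0 := by
      by_contra hz0
      have := mul_pos hτ (hS₁ z z.2 (fun h => hz0 (Subtype.ext h)))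
      linarith
    have hv0 := hZ₀ v v.2 (by linarith)
    refine ⟨hz, ?_, hv0.2⟩
    have h₆ : ‖Rᗮ.starProjection (momentum P v - (τ : ℂ) • antidiag n (v : C2n n).fst -
      (τ : ℂ) • antidiag n (z : diagSpace R))‖ ^ 2 = 0 := by linarith
    -- With p ∈ Rᗮ, q ∈ R and z = 0, the projected vector is -τp, so p = 0.
    rw [sq_eq_zero_iff, norm_eq_zero, hz, map_sub, map_sub, map_smul,
      Rᗮ.starProjection_apply_eq_zero_iff.2 (R.le_orthogonal_orthogonal hv0.2),
      Rᗮ.starProjection_eq_self_iff.2 hv0.1] at h₆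
    simp only [ZeroMemClass.coe_zero, map_zero, smul_zero, sub_zero, zero_sub, neg_eq_zero,
      smul_eq_zero, hτc, false_or] at h₆
    exact antidiag_injective h₆
  -- the positive part
  let Ψ : (Z' × S₂) →ₗ[ℂ] Rᗮ :=
    (Rᗮ.orthogonalProjectionOnto : C2n n →ₗ[ℂ] Rᗮ) ∘ₗ
      (((momentum P - (τ : ℂ) • ((antidiag n : Cn n →ₗ[ℂ] C2n n) ∘ₗ f)) ∘ₗ Z'.subtype).coprod
        (-((τ : ℂ) • ((antidiag n : Cn n →ₗ[ℂ] C2n n) ∘ₗ (diagSpace R).subtype ∘ₗ S₂.subtype))))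
  have hΨ : ∀ w : Z' × S₂, (Ψ w : C2n n) = Rᗮ.starProjection (momentum P w.1 -
      (τ : ℂ) • antidiag n (w.1 : C2n n).fst -
      (τ : ℂ) • antidiag n ((w.2 : diagSpace R) : Cn n)) := by
    intro w
    rw [sub_eq_add_neg _ ((τ : ℂ) • antidiag n ((w.2 : diagSpace R) : Cn n))]
    rfl
  let Θ : LinearMap.ker Ψ →ₗ[ℂ] Cn n :=
    ((f ∘ₗ Z'.subtype).coprod ((diagSpace R).subtype ∘ₗ S₂.subtype)) ∘ₗ (LinearMap.ker Ψ).subtype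
  have hΘ : ∀ w : LinearMap.ker Ψ,
      Θ w = ((w : Z' × S₂).1 : C2n n).fst + (((w : Z' × S₂).2 : diagSpace R) : Cn n) := fun w => rfl
  have hpos : ∀ w : LinearMap.ker Ψ, penaltyForm R P τ (Θ w) ≤ 0 → w = 0 := by
    rintro ⟨⟨v, z⟩, hk⟩ hw
    have hk' := hΨ (v, z)
    rw [LinearMap.mem_ker.1 hk] at hk'
    have hid := penaltyForm_identity R hP hτ (v : C2n n) (z : diagSpace R).2
    rw [hΘ] at hw
    simp only at hw hk'
    rw [← hk'] at hid
    have h₁ := mul_nonneg hτ.le (neg_nonneg.2 hw)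
    have h₂ := mul_nonneg hτ.le (neg_nonneg.2 (hS₂ z z.2))
    simp only [ZeroMemClass.coe_zero, norm_zero] at hid
    have hv : v = 0 := by
      by_contra hv0
      have := hZ' v v.2 (fun h => hv0 (Subtype.ext h))
      linarith
    have hz : z = 0 := by
      rw [hv] at hk'
      simp only [ZeroMemClass.coe_zero, map_zero, WithLp.zero_fst, smul_zero, sub_zero, zero_sub,
        map_neg, map_smul, hself] at hk'
      have h := (smul_eq_zero.1 (neg_eq_zero.1 hk'.symm)).resolve_left hτc
      exact Subtype.ext (Subtype.ext (antidiag_injective h))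
    exact Subtype.ext (Prod.ext hv hz)
  have hΘinj : LinearMap.ker Θ = ⊥ := by
    rw [LinearMap.ker_eq_bot']
    intro w hw
    refine hpos w ?_
    rw [hw]
    simp [penaltyForm]
  refine ⟨LinearMap.range Φ, LinearMap.range Θ, ?_, ?_, ?_, ?_⟩
  · rintro _ ⟨w, rfl⟩ hne
    by_contra! hcon
    obtain ⟨h₁, h₂, -⟩ := hneg w hcon
    exact hne (by rw [hΦ, h₁, h₂]; simp)
  · rintro _ ⟨w, rfl⟩ hne
    by_contra! hcon
    exact hne (by rw [hpos w hcon, map_zero])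
  · have h₁ := LinearMap.finrank_range_add_finrank_ker Φ
    rw [Module.finrank_prod] at h₁
    have hk : ∀ w : LinearMap.ker Φ, (w : Z × S₁).2 = 0 ∧ ((w : Z × S₁).1 : C2n n).fst = 0 ∧
        momentum P (w : Z × S₁).1 ∈ R := fun w => hneg w (by
      rw [LinearMap.mem_ker.1 w.2]; simp [penaltyForm])
    -- On the kernel x = 0 and z = 0, so q = (y, y) ∈ R, and y alone determines the vector.
    have h₂ : Module.finrank ℂ (LinearMap.ker Φ) ≤
        Module.finrank ℂ (R.comap (diagMap n)) := by
      refine LinearMap.finrank_le_finrank_of_injective (f := LinearMap.codRestrict _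
        (WithLp.sndₗ 2 ℂ (Cn n) (Cn n) ∘ₗ Z.subtype ∘ₗ LinearMap.fst ℂ Z S₁ ∘ₗ
          (LinearMap.ker Φ).subtype) ?_) ?_
      · intro w
        obtain ⟨-, h₀, hR⟩ := hk w
        rw [Submodule.mem_comap]
        convert hR using 1
        apply WithLp.ofLp_injective
        refine Prod.ext rfl ?_
        simp [diagMap, momentum, h₀]
      · intro w w' h
        obtain ⟨a₁, a₂, -⟩ := hk w
        obtain ⟨b₁, b₂, -⟩ := hk w'
        have h' : ((w : Z × S₁).1 : C2n n).snd = ((w' : Z × S₁).1 : C2n n).snd :=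
          congrArg Subtype.val h
        apply Subtype.ext
        refine Prod.ext (Subtype.ext ?_) (a₁.trans b₁.symm)
        apply WithLp.ofLp_injective
        exact Prod.ext (a₂.trans b₂.symm) h'
    omega
  · have h₀ := LinearMap.finrank_range_add_finrank_ker (V := LinearMap.ker Ψ) (V₂ := Cn n) Θ
    rw [hΘinj, finrank_bot] at h₀
    have h₁ := LinearMap.finrank_range_add_finrank_ker Ψ
    rw [Module.finrank_prod] at h₁
    have h₂ := Submodule.finrank_le (LinearMap.range Ψ)
    have h₃ := R.finrank_add_finrank_orthogonal
    rw [finrank_C2n] at h₃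
    have h₄ := finrank_comap_diagMap R
    -- dim ker Ψ ≥ dim Z' + dim S₂ - dim Rᗮ. Substituting the complementary dimensions gives dim R +
    -- dim S - dim Z - dim S₁, and `h₄` replaces dim R + dim S by n + d.
    omega

end Counting

/-! ### The isometries U and U' in the coordinates (x, -z) and (y, u). -/

section Coordinates

variable {n : ℕ}

theorem stdJ_apply (v : C2n n) : stdJ n v = WithLp.toLp 2 (-v.snd, v.fst) := by
  apply WithLp.ofLp_injective
  simp [stdJ, blockMatrix, blockOp]

theorem shearPath_apply (P : ℝ → Matrix (Fin n) (Fin n) ℂ) (t : ℝ) (v : C2n n) :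
    shearPath P t v =
      WithLp.toLp 2 (v.fst, Matrix.toEuclideanCLM (𝕜 := ℂ) (P t) v.fst + v.snd) := by
  apply WithLp.ofLp_injective
  simp [shearPath, blockMatrix, blockOp]

/-- The operator `diag(-J, J)` on `ℂ⁴ⁿ`. -/
abbrev stdDiff (n : ℕ) : WithLp 2 (C2n n × C2n n) →L[ℂ] WithLp 2 (C2n n × C2n n) :=
  diffStructure (stdJ n) (stdJ n)

theorem stdDiff_apply (v : WithLp 2 (C2n n × C2n n)) :
    stdDiff n v = WithLp.toLp 2
      (WithLp.toLp 2 (v.fst.snd, -v.fst.fst), WithLp.toLp 2 (-v.snd.snd, v.snd.fst)) := by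
  apply WithLp.ofLp_injective
  simp [diffStructure, blockOp, stdJ_apply]
  apply WithLp.ofLp_injective
  simp

/-- The coordinates `(x, -z)` of `(x, y, z, u)`, which determine a vector of either eigenspace
of `diag(-J, J)`. -/
def halfCoord (n : ℕ) : WithLp 2 (C2n n × C2n n) →ₗ[ℂ] C2n n where
  toFun v := WithLp.toLp 2 (v.fst.fst, -v.snd.fst)
  map_add' x y := by apply WithLp.ofLp_injective; ext <;> simp; abel
  map_smul' c x := by apply WithLp.ofLp_injective; ext <;> simp

/-- The coordinates `(y, u)` of `(x, y, z, u)`. -/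
def otherCoord (n : ℕ) : WithLp 2 (C2n n × C2n n) →ₗ[ℂ] C2n n where
  toFun v := WithLp.toLp 2 (v.fst.snd, v.snd.snd)
  map_add' x y := by apply WithLp.ofLp_injective; ext <;> simp
  map_smul' c x := by apply WithLp.ofLp_injective; ext <;> simp

theorem inner_eq_coord (v w : WithLp 2 (C2n n × C2n n)) :
    inner ℂ v w = inner ℂ (halfCoord n v) (halfCoord n w) +
      inner ℂ (otherCoord n v) (otherCoord n w) := by
  simp [halfCoord, otherCoord, WithLp.prod_inner_apply]
  ring

theorem mem_WR {R : Submodule ℂ (C2n n)} {v : WithLp 2 (C2n n × C2n n)} :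
    v ∈ WR R ↔ halfCoord n v ∈ Rᗮ ∧ otherCoord n v ∈ R := Iff.rfl

theorem otherCoord_plus {v : WithLp 2 (C2n n × C2n n)} (hv : v ∈ plusSpace (stdDiff n)) :
    otherCoord n v = Complex.I • halfCoord n v := by
  rw [Module.End.mem_eigenspace_iff, ContinuousLinearMap.coe_coe, stdDiff_apply] at hv
  have h₁ : v.fst.snd = Complex.I • v.fst.fst := congrArg (fun w => w.fst.fst) hv
  have h₂ : v.snd.fst = Complex.I • v.snd.snd := congrArg (fun w => w.snd.snd) hv
  apply WithLp.ofLp_injective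
  refine Prod.ext h₁ ?_
  show v.snd.snd = Complex.I • (-v.snd.fst)
  rw [h₂, smul_neg, smul_smul, Complex.I_mul_I, neg_one_smul, neg_neg]

theorem otherCoord_minus {v : WithLp 2 (C2n n × C2n n)} (hv : v ∈ minusSpace (stdDiff n)) :
    otherCoord n v = -(Complex.I • halfCoord n v) := by
  rw [Module.End.mem_eigenspace_iff, ContinuousLinearMap.coe_coe, stdDiff_apply] at hv
  have h₁ : v.fst.snd = -Complex.I • v.fst.fst := congrArg (fun w => w.fst.fst) hv
  have h₂ : v.snd.fst = -Complex.I • v.snd.snd := congrArg (fun w => w.snd.snd) hv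
  apply WithLp.ofLp_injective
  refine Prod.ext (h₁.trans (neg_smul _ _)) ?_
  show v.snd.snd = -(Complex.I • (-v.snd.fst))
  rw [h₂, smul_neg, neg_neg, smul_smul, mul_neg, Complex.I_mul_I, neg_neg, one_smul]

theorem inner_plus {v w : WithLp 2 (C2n n × C2n n)} (hv : v ∈ plusSpace (stdDiff n))
    (hw : w ∈ plusSpace (stdDiff n)) :
    inner ℂ v w = 2 * inner ℂ (halfCoord n v) (halfCoord n w) := by
  rw [inner_eq_coord, otherCoord_plus hv, otherCoord_plus hw, inner_smul_left, inner_smul_right,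
    Complex.conj_I]
  linear_combination (-inner ℂ (halfCoord n v) (halfCoord n w)) * Complex.I_sq

theorem inner_minus {v w : WithLp 2 (C2n n × C2n n)} (hv : v ∈ minusSpace (stdDiff n))
    (hw : w ∈ minusSpace (stdDiff n)) :
    inner ℂ v w = 2 * inner ℂ (halfCoord n v) (halfCoord n w) := by
  rw [inner_eq_coord, otherCoord_minus hv, otherCoord_minus hw, inner_neg_neg, inner_smul_left,
    inner_smul_right, Complex.conj_I]
  linear_combination (-inner ℂ (halfCoord n v) (halfCoord n w)) * Complex.I_sq

variable (U U' : plusSpace (stdDiff n) ≃ₗᵢ[ℂ] minusSpace (stdDiff n))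

theorem add_mem_isometryGraph (v : plusSpace (stdDiff n)) :
    (v : WithLp 2 (C2n n × C2n n)) + U v ∈ isometryGraph (stdDiff n) U := ⟨v, rfl⟩

/-- With h and h' the half coordinates of v and U'v, membership of v + U'v in W(R) says h + h' ∈ Rᗮ
and i(h - h') ∈ R. So h' agrees with h on Rᗮ and with -h on R. -/
theorem halfCoord_isometry {R : Submodule ℂ (C2n n)} (hU' : WR R = isometryGraph (stdDiff n) U')
    (v : plusSpace (stdDiff n)) :
    halfCoord n (U' v) = Rᗮ.starProjection (halfCoord n v) - R.starProjection (halfCoord n v) := by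
  have h := add_mem_isometryGraph U' v
  rw [← hU', mem_WR, map_add, map_add, otherCoord_plus v.2, otherCoord_minus (U' v).2,
    ← sub_eq_add_neg, ← smul_sub] at h
  have h₁ := R.starProjection_apply_eq_zero_iff.2 h.1
  have h₂ := Rᗮ.starProjection_apply_eq_zero_iff.2 (R.le_orthogonal_orthogonal
    ((R.smul_mem_iff Complex.I_ne_zero).1 h.2))
  rw [map_add] at h₁
  rw [map_sub] at h₂
  rw [sub_eq_zero.1 h₂, ← neg_eq_of_add_eq_zero_left h₁, sub_neg_eq_add, add_comm]
  exact (R.starProjection_add_starProjection_orthogonal _).symm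

/-- A graph vector has p = h + h' and q = i(h - h'), where h and h' are the half coordinates of v
and Uv; solve for h and h'. -/
theorem halfCoord_graph {P : Cn n →L[ℂ] Cn n} {M : C2n n →L[ℂ] C2n n}
    (hM : ∀ v, M v = WithLp.toLp 2 (v.fst, P v.fst + v.snd))
    (hU : graph M = isometryGraph (stdDiff n) U) (v : plusSpace (stdDiff n)) :
    (2 : ℂ) • halfCoord n v =
      antidiag n ((v : WithLp 2 (C2n n × C2n n)) + U v).fst.fst -
        Complex.I • momentum P ((v : WithLp 2 (C2n n × C2n n)) + U v).fst ∧
    (2 : ℂ) • halfCoord n (U v) =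
      antidiag n ((v : WithLp 2 (C2n n × C2n n)) + U v).fst.fst +
        Complex.I • momentum P ((v : WithLp 2 (C2n n × C2n n)) + U v).fst := by
  set l := (v : WithLp 2 (C2n n × C2n n)) + U v with hl
  have h : l ∈ graph M := hU ▸ add_mem_isometryGraph U v
  have hl₂ : l.snd = WithLp.toLp 2 (l.fst.fst, P l.fst.fst + l.fst.snd) :=
    Eq.trans h (hM _)
  have h₁ : antidiag n l.fst.fst = halfCoord n v + halfCoord n (U v) := by
    rw [← map_add, ← hl]
    apply WithLp.ofLp_injective
    refine Prod.ext rfl ?_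
    show -l.fst.fst = -l.snd.fst
    rw [hl₂]
    rfl
  have h₂ : momentum P l.fst = Complex.I • halfCoord n v - Complex.I • halfCoord n (U v) := by
    rw [sub_eq_add_neg, ← otherCoord_plus v.2, ← otherCoord_minus (U v).2, ← map_add, ← hl]
    apply WithLp.ofLp_injective
    refine Prod.ext rfl ?_
    show P l.fst.fst + l.fst.snd = l.snd.snd
    rw [hl₂]
    rfl
  rw [h₁, h₂, smul_sub, smul_smul, smul_smul, Complex.I_mul_I, two_smul, two_smul]
  constructor <;> module

/-- The Hermitian form of the unitary operator `U'⁻¹ U`, in the coordinates of the graph. -/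
theorem re_inner_eq_arcForm {R : Submodule ℂ (C2n n)} {P : Cn n →L[ℂ] Cn n}
    (hP : (P : Cn n →ₗ[ℂ] Cn n).IsSymmetric) {M : C2n n →L[ℂ] C2n n}
    (hM : ∀ v, M v = WithLp.toLp 2 (v.fst, P v.fst + v.snd))
    (hU : graph M = isometryGraph (stdDiff n) U) (hU' : WR R = isometryGraph (stdDiff n) U')
    {c s : ℝ} (hc : c ≠ 0) (v : plusSpace (stdDiff n)) :
    ((c - s * Complex.I) * inner ℂ v ((U.trans U'.symm) v)).re - c * ‖v‖ ^ 2 =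
      c * arcForm R (s / c)
        (antidiag n ((v : WithLp 2 (C2n n × C2n n)) + U v).fst.fst)
        (momentum P ((v : WithLp 2 (C2n n × C2n n)) + U v).fst) := by
  obtain ⟨h₁, h₂⟩ := halfCoord_graph U hM hU v
  set w := ((v : WithLp 2 (C2n n × C2n n)) + U v).fst
  set p := antidiag n w.fst
  set q := momentum P w
  -- The product is -(Px, x) up to conjugation, real because P is selfadjoint.
  have hpq : (inner ℂ p q).im = 0 := by
    rw [inner_antidiag_momentum]
    have h := im_inner_comm w.fst (P w.fst)
    have h' : inner ℂ (P w.fst) w.fst = inner ℂ w.fst (P w.fst) := hP w.fst w.fst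
    rw [h'] at h
    rw [Complex.neg_im]
    linarith
  have hinner : inner ℂ v ((U.trans U'.symm) v) = 2 * inner ℂ
      (Rᗮ.starProjection (halfCoord n v) - R.starProjection (halfCoord n v))
      (halfCoord n (U v)) := by
    rw [← halfCoord_isometry U' hU', ← inner_minus (U' v).2 (U v).2, ← Submodule.coe_inner,
      ← U'.inner_map_map]
    simp
  have hnorm : ‖v‖ ^ 2 = 2 * ‖halfCoord n v‖ ^ 2 := by
    rw [← re_inner_self_eq, Submodule.coe_inner, inner_plus v.2 v.2, ← re_inner_self_eq]
    simp
  have key := re_reflection_form R p q hpq c s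
  rw [← h₁, ← h₂] at key
  simp only [map_smul, ← smul_sub, inner_smul_left, inner_smul_right, norm_smul] at key
  rw [hinner, hnorm]
  have e : ∀ z : ℂ, ((c - s * Complex.I) * (2 * ((starRingEnd ℂ) 2 * z))).re =
      2 * ((c - s * Complex.I) * (2 * z)).re := by
    intro z
    simp
    ring
  rw [e] at key
  unfold arcForm
  have hsc : c * (s / c) = s := by field_simp
  have h2 : ‖(2 : ℂ)‖ = 2 := by simp
  rw [h2] at key
  linear_combination key / 2 - ((inner ℂ (Rᗮ.starProjection p) (Rᗮ.starProjection q)).re -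
      (inner ℂ (R.starProjection p) (R.starProjection q)).re) * hsc

end Coordinates

/-! ### Eigenvalue counts as dimensions of definite subspaces. -/

section Index

/-- For ν = e^{iθ} the left side is cos(θ - ε/2) - cos(ε/2), and the product formula displays its
zeros θ = 0 and θ = ε, the ends of the arc. -/
theorem arc_coefficient {ν : ℂ} (hν : ‖ν‖ = 1) (ε : ℝ) :
    (((Real.cos (ε / 2) : ℝ) - (Real.sin (ε / 2) : ℝ) * Complex.I) * ν).re - Real.cos (ε / 2) =
      2 * (Real.sin (ν.arg / 2) * Real.sin ((ε - ν.arg) / 2)) := by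
  have h₁ : ν.re = Real.cos ν.arg := by rw [← Complex.norm_mul_cos_arg, hν, one_mul]
  have h₂ : ν.im = Real.sin ν.arg := by rw [← Complex.norm_mul_sin_arg, hν, one_mul]
  have h₃ := Real.two_mul_sin_mul_sin (ν.arg / 2) ((ε - ν.arg) / 2)
  rw [show ν.arg / 2 - (ε - ν.arg) / 2 = ν.arg - ε / 2 by ring,
    show ν.arg / 2 + (ε - ν.arg) / 2 = ε / 2 by ring, Real.cos_sub] at h₃
  rw [← mul_assoc, h₃]
  simp only [Complex.mul_re, Complex.sub_re, Complex.sub_im, Complex.ofReal_re, Complex.ofReal_im,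
    Complex.mul_im, Complex.I_re, Complex.I_im, h₁, h₂]
  ring

variable {V : Type*} [NormedAddCommGroup V] [InnerProductSpace ℂ V] [FiniteDimensional ℂ V]

/-- The Hermitian form of the unitary operator `A` whose sign at an eigenvector tells whether the
eigenvalue lies on the arc from `1` to `exp (iε)`. -/
def unitaryForm (A : V ≃ₗᵢ[ℂ] V) (ε : ℝ) (v : V) : ℝ :=
  (((Real.cos (ε / 2) : ℝ) - (Real.sin (ε / 2) : ℝ) * Complex.I) * inner ℂ v (A v)).re -
    Real.cos (ε / 2) * ‖v‖ ^ 2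

/-- A unitary operator without the eigenvalue `exp (iε)` splits the space into a part of
dimension `upperCount A ε` on which the form of the arc `[0, ε]` is nonnegative, and vanishes
only on fixed vectors, and a part on which it is negative. -/
theorem exists_arc_splitting (A : V ≃ₗᵢ[ℂ] V) {ε : ℝ} (h0 : 0 < ε) (hπ : ε < Real.pi)
    (hA : ¬ Module.End.HasEigenvalue (A.toLinearEquiv : V →ₗ[ℂ] V)
      (Complex.exp (ε * Complex.I))) :
    ∃ V₁ V₂ : Submodule ℂ V, Module.finrank ℂ V₁ = upperCount A ε ∧
      Module.finrank ℂ V₁ + Module.finrank ℂ V₂ = Module.finrank ℂ V ∧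
      (∀ v ∈ V₁, 0 ≤ unitaryForm A ε v) ∧ (∀ v ∈ V₁, unitaryForm A ε v = 0 → A v = v) ∧
      (∀ v ∈ V₂, v ≠ 0 → unitaryForm A ε v < 0) := by
  obtain ⟨b, ν, hν⟩ := exists_orthonormal_eigenbasis A _ (Complex.norm_exp_ofReal_mul_I ε) hA
  have hν₁ : ∀ i, ‖ν i‖ = 1 := by
    intro i
    have := A.norm_map (b i)
    rwa [hν, norm_smul, b.orthonormal.1 i, mul_one] at this
  have hνε : ∀ i, (ν i).arg ≠ ε := by
    intro i hi
    apply hA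
    have hne : b i ≠ 0 := b.orthonormal.ne_zero i
    refine Module.End.hasEigenvalue_of_hasEigenvector (x := b i) ⟨?_, hne⟩
    rw [Module.End.mem_eigenspace_iff, ← hi]
    have := Complex.norm_mul_exp_arg_mul_I (ν i)
    rw [hν₁, Complex.ofReal_one, one_mul] at this
    rw [this]
    exact hν i
  obtain ⟨V₁, V₂, h₁, h₁₂, hV₁, hV₂⟩ := exists_spectral_splitting b
    (A.toLinearEquiv : V →ₗ[ℂ] V) ν hν (fun z => 0 ≤ Complex.arg z ∧ Complex.arg z < ε)
  let κ : Fin (Module.finrank ℂ V) → ℝ := fun i =>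
    2 * (Real.sin ((ν i).arg / 2) * Real.sin ((ε - (ν i).arg) / 2))
  have hsum : ∀ v, unitaryForm A ε v = ∑ i, κ i * ‖b.repr v i‖ ^ 2 := by
    intro v
    have hin : inner ℂ v (A v) = ∑ i, ν i * (‖b.repr v i‖ ^ 2 : ℝ) :=
      inner_apply_eq_sum b (A.toLinearEquiv : V →ₗ[ℂ] V) ν hν v
    simp only [unitaryForm, hin, norm_sq_eq_sum_repr b v, Finset.mul_sum, Complex.re_sum,
      ← Finset.sum_sub_distrib]
    refine Finset.sum_congr rfl fun i _ => ?_
    simp only [κ, ← arc_coefficient (hν₁ i) ε]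
    rw [← mul_assoc, Complex.re_mul_ofReal]
    ring
  -- The arc is closed at 1 and open at exp(iε), so the coefficient vanishes on it only at ν = 1.
  have hpos : ∀ i, 0 ≤ (ν i).arg → (ν i).arg < ε → 0 ≤ κ i ∧ (κ i = 0 → ν i = 1) := by
    intro i hi hiε
    have hs : 0 < Real.sin ((ε - (ν i).arg) / 2) :=
      Real.sin_pos_of_pos_of_lt_pi (by linarith) (by linarith)
    have hs' : 0 ≤ Real.sin ((ν i).arg / 2) :=
      Real.sin_nonneg_of_nonneg_of_le_pi (by linarith) (by linarith)
    refine ⟨by positivity, fun hκ => ?_⟩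
    have harg : (ν i).arg = 0 := by
      by_contra hne
      have : 0 < Real.sin ((ν i).arg / 2) :=
        Real.sin_pos_of_pos_of_lt_pi (by have := lt_of_le_of_ne hi (Ne.symm hne); linarith)
          (by linarith)
      have : 0 < κ i := by positivity
      linarith
    have := Complex.norm_mul_exp_arg_mul_I (ν i)
    rw [hν₁, harg] at this
    simpa using this.symm
  have hneg : ∀ i, ¬ (0 ≤ (ν i).arg ∧ (ν i).arg < ε) → κ i < 0 := by
    intro i hi
    have h₁ := Complex.arg_le_pi (ν i)
    have h₂ := Complex.neg_pi_lt_arg (ν i)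
    rcases lt_or_ge (ν i).arg 0 with hlt | hge
    · have hs : 0 < Real.sin ((ε - (ν i).arg) / 2) :=
        Real.sin_pos_of_pos_of_lt_pi (by linarith) (by linarith)
      have hs' : Real.sin ((ν i).arg / 2) < 0 :=
        Real.sin_neg_of_neg_of_neg_pi_lt (by linarith) (by linarith)
      have := mul_neg_of_neg_of_pos hs' hs
      simp only [κ]
      linarith
    · have hgt : ε < (ν i).arg :=
        lt_of_le_of_ne (not_lt.1 fun h => hi ⟨hge, h⟩) (Ne.symm (hνε i))
      have hs : Real.sin ((ε - (ν i).arg) / 2) < 0 :=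
        Real.sin_neg_of_neg_of_neg_pi_lt (by linarith) (by linarith)
      have hs' : 0 < Real.sin ((ν i).arg / 2) :=
        Real.sin_pos_of_pos_of_lt_pi (by linarith) (by linarith)
      have := mul_neg_of_pos_of_neg hs' hs
      simp only [κ]
      linarith
  have hterm : ∀ v ∈ V₁, ∀ i ∈ Finset.univ, 0 ≤ κ i * ‖b.repr v i‖ ^ 2 := by
    intro v hv i _
    by_cases hi : b.repr v i = 0
    · simp [hi]
    · have := hV₁ v hv i hi
      exact mul_nonneg (hpos i this.1 this.2).1 (sq_nonneg _)
  refine ⟨V₁, V₂, h₁, h₁₂, ?_, ?_, ?_⟩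
  · intro v hv
    rw [hsum]
    exact Finset.sum_nonneg (hterm v hv)
  · intro v hv hv0
    rw [hsum, Finset.sum_eq_zero_iff_of_nonneg (hterm v hv)] at hv0
    conv_lhs => rw [← b.sum_repr v]
    conv_rhs => rw [← b.sum_repr v]
    simp only [map_sum, map_smul, hν]
    refine Finset.sum_congr rfl fun i _ => ?_
    by_cases hi : b.repr v i = 0
    · simp [hi]
    · have hp := hV₁ v hv i hi
      have hκ := (mul_eq_zero.1 (hv0 i (Finset.mem_univ i))).resolve_right (by simpa using hi)
      rw [(hpos i hp.1 hp.2).2 hκ, one_smul]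
  · intro v hv hne
    rw [hsum]
    obtain ⟨j, hj⟩ : ∃ j, b.repr v j ≠ 0 := by
      by_contra! hall
      exact hne (b.repr.map_eq_zero_iff.1 (by ext j; exact hall j))
    refine Finset.sum_neg' (fun i _ => ?_) ⟨j, Finset.mem_univ j, ?_⟩
    · by_cases hi : b.repr v i = 0
      · simp [hi]
      · exact mul_nonpos_of_nonpos_of_nonneg (hneg i (hV₂ v hv i hi)).le (sq_nonneg _)
    · have : 0 < ‖b.repr v j‖ := norm_pos_iff.2 hj
      exact mul_neg_of_neg_of_pos (hneg j (hV₂ v hv j hj)) (by positivity)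

/-- The Morse positive index is the dimension of a positive subspace with a nonpositive
complement. -/
theorem exists_morse_splitting (P : V →L[ℂ] V) (hP : (P : V →ₗ[ℂ] V).IsSymmetric)
    (S : Submodule ℂ V) :
    ∃ S₁ S₂ : Submodule ℂ S, Module.finrank ℂ S₁ = morsePos (restrictForm P S) ∧
      Module.finrank ℂ S₁ + Module.finrank ℂ S₂ = Module.finrank ℂ S ∧
      (∀ z ∈ S₁, z ≠ 0 → 0 < (inner ℂ (z : V) (P z)).re) ∧
      (∀ z ∈ S₂, (inner ℂ (z : V) (P z)).re ≤ 0) := by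
  have hr : ∀ z w : S, inner ℂ z (restrictForm P S w) = inner ℂ (z : V) (P w) := by
    intro z w
    exact S.inner_orthogonalProjectionOnto_eq_of_mem_left z (P w)
  have hsym : (restrictForm P S).IsSymmetric := by
    intro z w
    rw [← inner_conj_symm, hr, hr, inner_conj_symm]
    exact hP z w
  let b := hsym.eigenvectorBasis rfl
  let μ : Fin (Module.finrank ℂ S) → ℝ := hsym.eigenvalues rfl
  have hμ : ∀ i, restrictForm P S (b i) = (μ i : ℂ) • b i := hsym.apply_eigenvectorBasis rfl
  obtain ⟨S₁, S₂, h₁, h₁₂, hS₁, hS₂⟩ := exists_spectral_splitting b (restrictForm P S)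
    (fun i => (μ i : ℂ)) hμ (fun z => 0 < z.re)
  have hsum : ∀ z : S, (inner ℂ (z : V) (P z)).re = ∑ i, μ i * ‖b.repr z i‖ ^ 2 := by
    intro z
    rw [← hr, inner_apply_eq_sum b _ _ hμ, Complex.re_sum]
    refine Finset.sum_congr rfl fun i _ => ?_
    rw [← Complex.ofReal_mul, Complex.ofReal_re]
  refine ⟨S₁, S₂, h₁, h₁₂, ?_, ?_⟩
  · intro z hz hne
    rw [hsum]
    obtain ⟨j, hj⟩ : ∃ j, b.repr z j ≠ 0 := by
      by_contra! hall
      exact hne (b.repr.map_eq_zero_iff.1 (by ext j; exact hall j))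
    refine Finset.sum_pos' (fun i _ => ?_) ⟨j, Finset.mem_univ j, ?_⟩
    · by_cases hi : b.repr z i = 0
      · simp [hi]
      · exact mul_nonneg (le_of_lt (by simpa using hS₁ z hz i hi)) (sq_nonneg _)
    · have : 0 < ‖b.repr z j‖ := norm_pos_iff.2 hj
      exact mul_pos (by simpa using hS₁ z hz j hj) (by positivity)
  · intro z hz
    rw [hsum]
    refine Finset.sum_nonpos fun i _ => ?_
    by_cases hi : b.repr z i = 0
    · simp [hi]
    · exact mul_nonpos_of_nonpos_of_nonneg (by simpa using hS₂ z hz i hi) (sq_nonneg _)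

end Index

/-! ### Identification of X₁ with the domain of a graph. -/

section GraphCoordinates

variable {E X Y : Type*} [NormedAddCommGroup E] [InnerProductSpace ℂ E]
  [NormedAddCommGroup X] [InnerProductSpace ℂ X]
  [NormedAddCommGroup Y] [InnerProductSpace ℂ Y]

theorem eq_zero_of_plus_add_minus {J : E →L[ℂ] E} {a b : E} (ha : a ∈ plusSpace J)
    (hb : b ∈ minusSpace J) (hab : a + b = 0) : a = 0 ∧ b = 0 := by
  rw [Module.End.mem_eigenspace_iff, ContinuousLinearMap.coe_coe] at ha hb
  have h := congrArg J hab
  rw [map_add, ha, hb, map_zero, neg_smul, ← sub_eq_add_neg, ← smul_sub,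
    smul_eq_zero_iff_right Complex.I_ne_zero, sub_eq_zero] at h
  rw [← h, ← two_smul ℂ, smul_eq_zero_iff_right two_ne_zero] at hab
  exact ⟨hab, h ▸ hab⟩

/-- The graph of `M` and the graph of `U` coincide; so their domains are isomorphic. -/
def graphDomainEquiv {J : WithLp 2 (X × Y) →L[ℂ] WithLp 2 (X × Y)}
    (U : plusSpace J ≃ₗᵢ[ℂ] minusSpace J) {M : X →L[ℂ] Y} (hU : graph M = isometryGraph J U) :
    plusSpace J ≃ₗ[ℂ] X :=
  LinearEquiv.ofBijective (WithLp.fstₗ 2 ℂ X Y ∘ₗ ((plusSpace J).subtype +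
    (minusSpace J).subtype ∘ₗ (U.toLinearEquiv : plusSpace J →ₗ[ℂ] minusSpace J))) <| by
    constructor
    · rw [← LinearMap.ker_eq_bot, LinearMap.ker_eq_bot']
      intro v hv
      have hv' : ((v : WithLp 2 (X × Y)) + U v).fst = 0 := hv
      have hg : (v : WithLp 2 (X × Y)) + U v ∈ graph M := hU ▸ ⟨v, rfl⟩
      have hs : ((v : WithLp 2 (X × Y)) + U v).snd = M ((v : WithLp 2 (X × Y)) + U v).fst := hg
      rw [hv', map_zero] at hs
      have h0 : (v : WithLp 2 (X × Y)) + U v = 0 := WithLp.ofLp_injective 2 (Prod.ext hv' hs)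
      exact Subtype.ext (eq_zero_of_plus_add_minus v.2 (U v).2 h0).1
    · intro x
      have hx : WithLp.toLp 2 (x, M x) ∈ isometryGraph J U := hU ▸ rfl
      obtain ⟨v, hv⟩ := hx
      exact ⟨v, congrArg WithLp.fst hv⟩

end GraphCoordinates

/-! ### The penalty form attached to U'⁻¹U. -/

section Main

variable {n : ℕ}

/-- The two inequalities, together with dim V₁ + dim V₂ ≤ n, force equality in both. The penalty
form involves only P, R and ε, not U or U', so it varies continuously with P. -/
theorem exists_definite_of_unitary {R : Submodule ℂ (C2n n)} {P : Cn n →L[ℂ] Cn n}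
    (hP : (P : Cn n →ₗ[ℂ] Cn n).IsSymmetric) {M : C2n n →L[ℂ] C2n n}
    (hM : ∀ v, M v = WithLp.toLp 2 (v.fst, P v.fst + v.snd))
    (U U' : plusSpace (stdDiff n) ≃ₗᵢ[ℂ] minusSpace (stdDiff n))
    (hU : graph M = isometryGraph (stdDiff n) U) (hU' : WR R = isometryGraph (stdDiff n) U')
    {ε : ℝ} (h0 : 0 < ε) (hπ : ε < Real.pi)
    (hA : ¬ Module.End.HasEigenvalue ((U.trans U'.symm).toLinearEquiv :
      plusSpace (stdDiff n) →ₗ[ℂ] plusSpace (stdDiff n)) (Complex.exp (ε * Complex.I))) :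
    ∃ V₁ V₂ : Submodule ℂ (Cn n),
      (∀ x ∈ V₁, x ≠ 0 → penaltyForm R P (Real.sin (ε / 2) / Real.cos (ε / 2)) x < 0) ∧
      (∀ x ∈ V₂, x ≠ 0 → 0 < penaltyForm R P (Real.sin (ε / 2) / Real.cos (ε / 2)) x) ∧
      upperCount (U.trans U'.symm) ε + morsePos (restrictForm P (diagSpace R)) ≤
        Module.finrank ℂ V₁ + Module.finrank ℂ (R.comap (diagMap n)) ∧
      n + Module.finrank ℂ (R.comap (diagMap n)) ≤ Module.finrank ℂ V₂ +
        (upperCount (U.trans U'.symm) ε + morsePos (restrictForm P (diagSpace R))) := by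
  have hc : 0 < Real.cos (ε / 2) := Real.cos_pos_of_mem_Ioo ⟨by linarith, by linarith⟩
  have hs : 0 < Real.sin (ε / 2) := Real.sin_pos_of_pos_of_lt_pi (by linarith) (by linarith)
  obtain ⟨V₁, V₂, hN, hd, hV₁, hV₁', hV₂⟩ := exists_arc_splitting (U.trans U'.symm) h0 hπ hA
  obtain ⟨S₁, S₂, hm, hS, hS₁, hS₂⟩ := exists_morse_splitting P hP (diagSpace R)
  let T := graphDomainEquiv U hU
  have key : ∀ v, unitaryForm (U.trans U'.symm) ε v =
      Real.cos (ε / 2) * arcForm R (Real.sin (ε / 2) / Real.cos (ε / 2))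
        (antidiag n (T v).fst) (momentum P (T v)) :=
    fun v => re_inner_eq_arcForm U U' hP hM hU hU' hc.ne' v
  rw [← hN, ← hm, ← T.finrank_map_eq V₁]
  refine exists_definite_subspaces R hP (div_pos hs hc)
    (V₁.map (T : plusSpace (stdDiff n) →ₗ[ℂ] C2n n))
    (V₂.map (T : plusSpace (stdDiff n) →ₗ[ℂ] C2n n)) ?_ ?_ ?_ ?_ S₁ S₂ hS hS₁ hS₂
  · rw [T.finrank_map_eq, T.finrank_map_eq, hd, T.finrank_eq, finrank_C2n]
  · rintro _ ⟨v, hv, rfl⟩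
    have := hV₁ v hv
    rw [key] at this
    exact nonneg_of_mul_nonneg_right this hc
  · rintro _ ⟨v, hv, rfl⟩ h
    have hAv := hV₁' v hv ((key v).trans (mul_eq_zero_of_right _ h))
    -- A zero of the form in V₁ is a fixed vector of U'⁻¹U, so v + Uv lies in both the graph and
    -- W(R).
    have hUv : U v = U' v := by
      rw [← U'.symm_apply_eq]
      exact hAv
    have hgr : (v : WithLp 2 (C2n n × C2n n)) + U v ∈ graph M := hU ▸ add_mem_isometryGraph U v
    have hWR : (v : WithLp 2 (C2n n × C2n n)) + U v ∈ WR R :=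
      hUv ▸ hU' ▸ add_mem_isometryGraph U' v
    have hTv : T v = ((v : WithLp 2 (C2n n × C2n n)) + U v).fst := rfl
    show antidiag n (T v).fst ∈ Rᗮ ∧ momentum P (T v) ∈ R
    rw [hTv]
    set l := (v : WithLp 2 (C2n n × C2n n)) + U v
    have hl : l.snd = WithLp.toLp 2 (l.fst.fst, P l.fst.fst + l.fst.snd) := Eq.trans hgr (hM _)
    refine ⟨?_, ?_⟩
    · convert hWR.1 using 1
      rw [hl]
      rfl
    · convert hWR.2 using 1
      rw [hl]
      rfl
  · rintro _ ⟨v, hv, rfl⟩ hne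
    have := hV₂ v hv (fun h => hne (by rw [h, map_zero]))
    rw [key] at this
    exact neg_of_mul_neg_right this hc.le


end Main

/-! ### Local constancy of the index. -/

section Stability

variable {n : ℕ} (R : Submodule ℂ (C2n n))

theorem penaltyForm_smul (P : Cn n →L[ℂ] Cn n) (τ r : ℝ) (x : Cn n) :
    penaltyForm R P τ ((r : ℂ) • x) = r ^ 2 * penaltyForm R P τ x := by
  unfold penaltyForm
  simp only [map_smul, inner_smul_left, inner_smul_right, norm_smul, Complex.conj_ofReal,
    Complex.norm_real, Complex.re_ofReal_mul, mul_pow, Real.norm_eq_abs, sq_abs]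
  ring

theorem continuous_penaltyForm (P : Cn n →L[ℂ] Cn n) (τ : ℝ) :
    Continuous (penaltyForm R P τ) := by
  unfold penaltyForm
  have : Continuous fun x : Cn n => (inner ℂ x (P x)).re :=
    Complex.continuous_re.comp (continuous_id.inner P.continuous)
  fun_prop

theorem abs_penaltyForm_sub_le (P Q : Cn n →L[ℂ] Cn n) (τ : ℝ) (x : Cn n) :
    |penaltyForm R Q τ x - penaltyForm R P τ x| ≤ ‖Q - P‖ * ‖x‖ ^ 2 := by
  have h : penaltyForm R Q τ x - penaltyForm R P τ x = -(inner ℂ x ((Q - P) x)).re := by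
    unfold penaltyForm
    rw [sub_apply, inner_sub_right, Complex.sub_re]
    ring
  rw [h, abs_neg]
  calc |(inner ℂ x ((Q - P) x)).re| ≤ ‖inner ℂ x ((Q - P) x)‖ := Complex.abs_re_le_norm _
    _ ≤ ‖x‖ * ‖(Q - P) x‖ := norm_inner_le_norm _ _
    _ ≤ ‖x‖ * (‖Q - P‖ * ‖x‖) := by gcongr; exact (Q - P).le_opNorm x
    _ = ‖Q - P‖ * ‖x‖ ^ 2 := by ring

/-- Definiteness of the penalty form on a subspace is an open condition. -/
theorem exists_penaltyForm_definite_near (P : Cn n →L[ℂ] Cn n) (τ : ℝ) {σ : ℝ} (hσ : |σ| = 1)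
    (V : Submodule ℂ (Cn n)) (hV : ∀ x ∈ V, x ≠ 0 → 0 < σ * penaltyForm R P τ x) :
    ∃ δ > 0, ∀ Q : Cn n →L[ℂ] Cn n, ‖Q - P‖ < δ →
      ∀ x ∈ V, x ≠ 0 → 0 < σ * penaltyForm R Q τ x := by
  -- The minimum over the unit sphere of V is a margin that a perturbation of smaller norm cannot
  -- use up. If V = 0 the sphere is empty and any positive margin serves.
  have hK : IsCompact (Metric.sphere (0 : Cn n) 1 ∩ V) :=
    (isCompact_sphere _ _).inter_right V.closed_of_finiteDimensional
  have hδ : ∃ δ > 0, ∀ u ∈ Metric.sphere (0 : Cn n) 1 ∩ V, δ ≤ σ * penaltyForm R P τ u := by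
    rcases (Metric.sphere (0 : Cn n) 1 ∩ V).eq_empty_or_nonempty with he | hne
    · exact ⟨1, one_pos, fun u hu => by simp [he] at hu⟩
    · obtain ⟨u₀, hu₀, hmin⟩ := hK.exists_isMinOn hne
        (continuous_const.mul (continuous_penaltyForm R P τ)).continuousOn
      refine ⟨_, hV u₀ hu₀.2 ?_, fun u hu => hmin hu⟩
      rintro rfl
      simpa using hu₀.1
  obtain ⟨δ, hδ0, hδ⟩ := hδ
  refine ⟨δ, hδ0, fun Q hQ x hx hx0 => ?_⟩
  have hn : 0 < ‖x‖ := norm_pos_iff.2 hx0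
  set u : Cn n := ((‖x‖⁻¹ : ℝ) : ℂ) • x with hu
  have hu1 : ‖u‖ = 1 := by
    rw [hu, norm_smul, Complex.norm_real, norm_inv, norm_norm, inv_mul_cancel₀ hn.ne']
  have hxu : x = ((‖x‖ : ℝ) : ℂ) • u := by
    rw [hu, smul_smul, ← Complex.ofReal_mul, mul_inv_cancel₀ hn.ne', Complex.ofReal_one, one_smul]
  have h₁ := hδ u ⟨by simpa using hu1, V.smul_mem _ hx⟩
  have h₂ := abs_penaltyForm_sub_le R P Q τ u
  rw [hu1, one_pow, mul_one] at h₂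
  have h₃ : |σ * penaltyForm R Q τ u - σ * penaltyForm R P τ u| < δ := by
    rw [← mul_sub, abs_mul, hσ, one_mul]
    exact h₂.trans_lt hQ
  have h₄ := (abs_lt.1 h₃).1
  rw [hxu, penaltyForm_smul]
  have : 0 < σ * penaltyForm R Q τ u := by linarith
  have := mul_pos (pow_pos hn 2) this
  linarith

theorem finrank_add_le_of_definite {P : Cn n →L[ℂ] Cn n} {τ : ℝ} {V₁ V₂ : Submodule ℂ (Cn n)}
    (h₁ : ∀ x ∈ V₁, x ≠ 0 → penaltyForm R P τ x < 0)
    (h₂ : ∀ x ∈ V₂, x ≠ 0 → 0 < penaltyForm R P τ x) :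
    Module.finrank ℂ V₁ + Module.finrank ℂ V₂ ≤ n := by
  have hd : Disjoint V₁ V₂ := by
    rw [Submodule.disjoint_def]
    intro x hx₁ hx₂
    by_contra hne
    exact lt_asymm (h₁ x hx₁ hne) (h₂ x hx₂ hne)
  have := Submodule.finrank_add_finrank_le_of_disjoint hd
  rwa [finrank_Cn] at this

/-- An integer function that is pinned by subspaces on which a continuous family of penalty forms
is definite is constant on intervals. -/
theorem eq_of_definite_subspaces {P : ℝ → Cn n →L[ℂ] Cn n} {τ : ℝ} {a b : ℝ}
    (hP : ContinuousOn P (Icc a b)) {F : ℝ → ℕ} {d : ℕ}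
    (hF : ∀ t ∈ Icc a b, ∃ V₁ V₂ : Submodule ℂ (Cn n),
      (∀ x ∈ V₁, x ≠ 0 → penaltyForm R (P t) τ x < 0) ∧
      (∀ x ∈ V₂, x ≠ 0 → 0 < penaltyForm R (P t) τ x) ∧
      F t ≤ Module.finrank ℂ V₁ + d ∧ n + d ≤ Module.finrank ℂ V₂ + F t) (hab : a ≤ b) :
    F a = F b := by
  refine isPreconnected_Icc.constant (f := F) ?_ (left_mem_Icc.2 hab) (right_mem_Icc.2 hab)
  intro t₀ ht₀
  refine (tendsto_pure.2 ?_).mono_right (pure_le_nhds _)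
  obtain ⟨V₁, V₂, h₁, h₂, hd₁, hd₂⟩ := hF t₀ ht₀
  obtain ⟨δ₁, hδ₁, hV₁⟩ := exists_penaltyForm_definite_near R (P t₀) τ (σ := -1) (by simp) V₁
    (fun x hx hne => by have := h₁ x hx hne; linarith)
  obtain ⟨δ₂, hδ₂, hV₂⟩ := exists_penaltyForm_definite_near R (P t₀) τ (σ := 1) (by simp) V₂
    (fun x hx hne => by have := h₂ x hx hne; linarith)
  have hev : ∀ᶠ t in 𝓝[Icc a b] t₀, ‖P t - P t₀‖ < min δ₁ δ₂ := by
    have := (hP t₀ ht₀).eventually (Metric.ball_mem_nhds (P t₀) (lt_min hδ₁ hδ₂))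
    filter_upwards [this] with t ht
    rwa [← dist_eq_norm]
  filter_upwards [hev, self_mem_nhdsWithin] with t ht htI
  obtain ⟨W₁, W₂, g₁, g₂, e₁, e₂⟩ := hF t htI
  -- The subspaces from t₀ keep their signs at t. Pairing the old negative with the new positive one
  -- gives F t₀ ≤ F t; the opposite pairing gives F t ≤ F t₀.
  have k₁ := finrank_add_le_of_definite R (P := P t) (V₁ := V₁)
    (fun x hx hne => by
      have := hV₁ (P t) (ht.trans_le (min_le_left _ _)) x hx hne; linarith) g₂
  have k₂ := finrank_add_le_of_definite R (P := P t) (V₂ := V₂) g₁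
    (fun x hx hne => by
      have := hV₂ (P t) (ht.trans_le (min_le_right _ _)) x hx hne; linarith)
  omega

end Stability

/-! ### Lagrange subspaces as graphs of isometries. -/

section Lagrangian

variable {E : Type*} [NormedAddCommGroup E] [InnerProductSpace ℂ E]

theorem inner_plus_minus {J : E →L[ℂ] E} (hJ : IsCompatible J) {a b : E} (ha : a ∈ plusSpace J)
    (hb : b ∈ minusSpace J) : inner ℂ a b = 0 := by
  rw [Module.End.mem_eigenspace_iff, ContinuousLinearMap.coe_coe] at ha hb
  have h := hJ.1 a b
  rw [ha, hb, inner_smul_left, inner_smul_right, Complex.conj_I] at h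
  have h' : (2 * Complex.I) * inner ℂ a b = 0 := by linear_combination -h
  exact (mul_eq_zero.1 h').resolve_left (by simp)

theorem norm_add_plus_minus {J : E →L[ℂ] E} (hJ : IsCompatible J) {a b : E}
    (ha : a ∈ plusSpace J) (hb : b ∈ minusSpace J) : ‖a + b‖ ^ 2 = ‖a‖ ^ 2 + ‖b‖ ^ 2 := by
  have := norm_add_sq_eq_norm_sq_add_norm_sq_of_inner_eq_zero a b (inner_plus_minus hJ ha hb)
  nlinarith

/-- The projection onto `ker (J - √-1 I)`. -/
def plusProj {J : E →L[ℂ] E} (hJ : IsCompatible J) : E →ₗ[ℂ] plusSpace J :=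
  LinearMap.codRestrict _ ((2⁻¹ : ℂ) • (LinearMap.id - Complex.I • (J : E →ₗ[ℂ] E))) <| by
    intro v
    rw [Module.End.mem_eigenspace_iff]
    simp only [LinearMap.smul_apply, LinearMap.sub_apply, LinearMap.id_apply,
      ContinuousLinearMap.coe_coe, map_smul, map_sub, hJ.2]
    rw [smul_comm, smul_sub Complex.I, smul_smul Complex.I, Complex.I_mul_I]
    congr 1
    simp [add_comm, sub_eq_add_neg]

/-- The projection onto `ker (J + √-1 I)`. -/
def minusProj {J : E →L[ℂ] E} (hJ : IsCompatible J) : E →ₗ[ℂ] minusSpace J :=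
  LinearMap.codRestrict _ ((2⁻¹ : ℂ) • (LinearMap.id + Complex.I • (J : E →ₗ[ℂ] E))) <| by
    intro v
    rw [Module.End.mem_eigenspace_iff]
    simp only [LinearMap.smul_apply, LinearMap.add_apply, LinearMap.id_apply,
      ContinuousLinearMap.coe_coe, map_smul, map_add, hJ.2]
    rw [smul_comm, smul_add (-Complex.I), smul_smul (-Complex.I), neg_mul, Complex.I_mul_I]
    congr 1
    simp [add_comm]

theorem plusProj_add_minusProj {J : E →L[ℂ] E} (hJ : IsCompatible J) (v : E) :
    (plusProj hJ v : E) + minusProj hJ v = v := by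
  simp only [plusProj, minusProj, LinearMap.codRestrict_apply, LinearMap.smul_apply,
    LinearMap.add_apply, LinearMap.sub_apply, LinearMap.id_apply]
  rw [← smul_add, sub_add_add_cancel, ← two_smul ℂ v, smul_smul]
  norm_num

theorem omega_self {J : E →L[ℂ] E} (hJ : IsCompatible J) (v : E) :
    omega J v v = Complex.I * (‖plusProj hJ v‖ ^ 2 - ‖minusProj hJ v‖ ^ 2 : ℝ) := by
  have ha := (plusProj hJ v).2
  have hb := (minusProj hJ v).2
  have hab := inner_plus_minus hJ ha hb
  have hba : inner ℂ (minusProj hJ v : E) (plusProj hJ v : E) = 0 := by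
    rw [← inner_conj_symm, hab, map_zero]
  have hJv : J v = Complex.I • (plusProj hJ v : E) - Complex.I • (minusProj hJ v : E) := by
    conv_lhs => rw [← plusProj_add_minusProj hJ v, map_add]
    rw [Module.End.mem_eigenspace_iff, ContinuousLinearMap.coe_coe] at ha hb
    rw [ha, hb, neg_smul, sub_eq_add_neg]
  unfold omega
  rw [hJv]
  conv_lhs => enter [2]; rw [← plusProj_add_minusProj hJ v]
  rw [inner_sub_right, inner_smul_right, inner_smul_right, inner_add_left, inner_add_left, hab,
    hba, inner_self_eq_norm_sq_to_K, inner_self_eq_norm_sq_to_K]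
  simp
  ring

variable [FiniteDimensional ℂ E]

theorem finrank_plus_add_minus {J : E →L[ℂ] E} (hJ : IsCompatible J) :
    Module.finrank ℂ (plusSpace J) + Module.finrank ℂ (minusSpace J) = Module.finrank ℂ E := by
  refine Submodule.finrank_add_eq_of_isCompl (IsCompl.of_eq ?_ ?_)
  · rw [Submodule.eq_bot_iff]
    rintro x ⟨h₁, h₂⟩
    exact (eq_zero_of_plus_add_minus h₁ ((minusSpace J).neg_mem h₂) (add_neg_cancel x)).1
  · rw [Submodule.eq_top_iff']
    intro x
    rw [← plusProj_add_minusProj hJ x]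
    exact Submodule.add_mem_sup (plusProj hJ x).2 (minusProj hJ x).2

/-- The symplectic complement of Λ is (JΛ)ᗮ. It contains Λ by isotropy and has the same dimension
because J is injective. -/
theorem isLagrange_of_isotropic {J : E →L[ℂ] E} (hJ : IsCompatible J) {Λ : Submodule ℂ E}
    (hΛ : ∀ x ∈ Λ, ∀ y ∈ Λ, omega J x y = 0)
    (hd : Module.finrank ℂ Λ + Module.finrank ℂ Λ = Module.finrank ℂ E) : IsLagrange J Λ := by
  have hinj : Function.Injective (J : E →ₗ[ℂ] E) := by
    intro x y hxy
    have h := congrArg J hxy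
    simp only [ContinuousLinearMap.coe_coe, hJ.2] at h
    exact neg_injective h
  have hle : Λ ≤ (Λ.map (J : E →ₗ[ℂ] E))ᗮ := by
    intro y hy
    rw [Submodule.mem_orthogonal']
    rintro _ ⟨x, hx, rfl⟩
    exact hΛ x hx y hy
  have h₁ := (Λ.map (J : E →ₗ[ℂ] E)).finrank_add_finrank_orthogonal
  rw [LinearEquiv.finrank_eq (Submodule.equivMapOfInjective _ hinj Λ).symm] at h₁
  have heq := Submodule.eq_of_le_of_finrank_eq hle (by omega)
  intro y
  constructor
  · intro h
    rw [heq, Submodule.mem_orthogonal']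
    rintro _ ⟨x, hx, rfl⟩
    exact h x hx
  · exact fun hy x hx => hΛ x hx y hy

/-- A Lagrange subspace is the graph of an isometry. -/
theorem exists_eq_isometryGraph {J : E →L[ℂ] E} (hJ : IsCompatible J) {Λ : Submodule ℂ E}
    (hΛ : ∀ x ∈ Λ, ∀ y ∈ Λ, omega J x y = 0)
    (hd : Module.finrank ℂ Λ + Module.finrank ℂ Λ = Module.finrank ℂ E) :
    ∃ U : plusSpace J ≃ₗᵢ[ℂ] minusSpace J, Λ = isometryGraph J U := by
  -- By `omega_self`, ω(v, v) = 0 equates the two norms, so both projections are injective on Λ.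
  -- Since dim X₁ + dim X₂ = 2 dim Λ, they are bijective, and U carries one to the other.
  have hnorm : ∀ v : Λ, ‖plusProj hJ v‖ = ‖minusProj hJ v‖ := by
    intro v
    have h := omega_self hJ (v : E)
    rw [hΛ v v.2 v v.2] at h
    have h' := (mul_eq_zero.1 h.symm).resolve_left Complex.I_ne_zero
    rw [Complex.ofReal_eq_zero, sub_eq_zero] at h'
    exact (sq_eq_sq₀ (norm_nonneg _) (norm_nonneg _)).1 h'
  have hzero : ∀ v : Λ, plusProj hJ v = 0 → v = 0 := by
    intro v h
    have h₂ : minusProj hJ v = 0 := by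
      rw [← norm_eq_zero, ← hnorm, h, norm_zero]
    apply Subtype.ext
    rw [← plusProj_add_minusProj hJ v, h, h₂]
    simp
  have hzero' : ∀ v : Λ, minusProj hJ v = 0 → v = 0 := by
    intro v h
    exact hzero v (by rw [← norm_eq_zero, hnorm, h, norm_zero])
  have h₁ : Function.Injective (plusProj hJ ∘ₗ Λ.subtype) :=
    (injective_iff_map_eq_zero _).2 hzero
  have h₂ : Function.Injective (minusProj hJ ∘ₗ Λ.subtype) :=
    (injective_iff_map_eq_zero _).2 hzero'
  have d₁ := LinearMap.finrank_le_finrank_of_injective h₁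
  have d₂ := LinearMap.finrank_le_finrank_of_injective h₂
  have d₃ := finrank_plus_add_minus hJ
  let e₁ := LinearMap.linearEquivOfInjective _ h₁ (by omega)
  let e₂ := LinearMap.linearEquivOfInjective _ h₂ (by omega)
  have he₁ : ∀ v, e₁ v = plusProj hJ v := fun v => rfl
  have he₂ : ∀ v, e₂ v = minusProj hJ v := fun v => rfl
  let U : plusSpace J ≃ₗᵢ[ℂ] minusSpace J := ⟨e₁.symm ≪≫ₗ e₂, fun a => by
    obtain ⟨v, rfl⟩ := e₁.surjective a
    rw [LinearEquiv.trans_apply, e₁.symm_apply_apply, he₁, he₂, hnorm]⟩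
  have hU : ∀ v : Λ, (plusProj hJ v : E) + U (plusProj hJ v) = v := by
    intro v
    have : U (plusProj hJ v) = minusProj hJ v := by
      rw [← he₁, ← he₂]
      show e₂ (e₁.symm (e₁ v)) = _
      rw [e₁.symm_apply_apply]
    rw [this, plusProj_add_minusProj]
  refine ⟨U, le_antisymm ?_ ?_⟩
  · intro v hv
    exact ⟨plusProj hJ v, hU ⟨v, hv⟩⟩
  · rintro _ ⟨a, rfl⟩
    obtain ⟨v, rfl⟩ := e₁.surjective a
    have : (plusProj hJ v : E) + U (plusProj hJ v) ∈ Λ := by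
      rw [hU]
      exact v.2
    exact this

end Lagrangian

/-! ### Continuity of the isometry of a moving graph. -/

section GraphContinuity

variable {X Y : Type*} [NormedAddCommGroup X] [InnerProductSpace ℂ X] [FiniteDimensional ℂ X]
  [NormedAddCommGroup Y] [InnerProductSpace ℂ Y] [FiniteDimensional ℂ Y]

/-- In finite dimension it suffices to fix v. Keep the base point x of v + U(t₀)v and let a + U(t)a
be the graph point over x at time t. The two points differ by (0, (M t - M t₀)x), which by
orthogonality bounds both a - v and U(t)a - U(t₀)v. Since U(t) is isometric, replacing a by v costs
one more such bound, whence the factor 2. -/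
theorem continuousOn_of_graph {J : WithLp 2 (X × Y) →L[ℂ] WithLp 2 (X × Y)} (hJ : IsCompatible J)
    {M : ℝ → X →L[ℂ] Y} {s : Set ℝ} (hM : ContinuousOn M s)
    {U : ℝ → (plusSpace J ≃ₗᵢ[ℂ] minusSpace J)}
    (hU : ∀ t ∈ s, graph (M t) = isometryGraph J (U t)) :
    ContinuousOn (fun t => ((U t : plusSpace J ≃L[ℂ] minusSpace J) :
      plusSpace J →L[ℂ] minusSpace J)) s := by
  rw [continuousOn_clm_apply]
  intro v t₀ ht₀
  set x := ((v : WithLp 2 (X × Y)) + U t₀ v).fst with hx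
  have hl₀ : (v : WithLp 2 (X × Y)) + U t₀ v = WithLp.toLp 2 (x, M t₀ x) := by
    have h : (v : WithLp 2 (X × Y)) + U t₀ v ∈ graph (M t₀) := hU t₀ ht₀ ▸ ⟨v, rfl⟩
    exact WithLp.ofLp_injective 2 (Prod.ext rfl h)
  have hbound : ∀ t ∈ s, ‖U t v - U t₀ v‖ ≤ 2 * ‖WithLp.toLp 2 ((0 : X), M t x - M t₀ x)‖ := by
    intro t ht
    have h : WithLp.toLp 2 (x, M t x) ∈ isometryGraph J (U t) := hU t ht ▸ rfl
    obtain ⟨a, ha⟩ := h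
    have ha' : (a : WithLp 2 (X × Y)) + U t a = WithLp.toLp 2 (x, M t x) := ha
    have hdiff : ((a - v : plusSpace J) : WithLp 2 (X × Y)) +
        ((U t a - U t₀ v : minusSpace J) : WithLp 2 (X × Y)) =
        WithLp.toLp 2 ((0 : X), M t x - M t₀ x) := by
      rw [show (0 : X) = x - x from (sub_self x).symm, ← Prod.mk_sub_mk, WithLp.toLp_sub, ← hl₀,
        ← ha', Submodule.coe_sub, Submodule.coe_sub]
      abel
    have hsq := norm_add_plus_minus hJ (a - v).2 (U t a - U t₀ v).2
    rw [hdiff] at hsq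
    have h₁ : ‖a - v‖ ≤ ‖WithLp.toLp 2 ((0 : X), M t x - M t₀ x)‖ :=
      (sq_le_sq₀ (norm_nonneg _) (norm_nonneg _)).1 (by
        rw [hsq, Submodule.coe_norm]; exact le_add_of_nonneg_right (sq_nonneg _))
    have h₂ : ‖U t a - U t₀ v‖ ≤ ‖WithLp.toLp 2 ((0 : X), M t x - M t₀ x)‖ :=
      (sq_le_sq₀ (norm_nonneg _) (norm_nonneg _)).1 (by
        rw [hsq, Submodule.coe_norm]; exact le_add_of_nonneg_left (sq_nonneg _))
    calc ‖U t v - U t₀ v‖ = ‖(U t a - U t₀ v) - U t (a - v)‖ := by rw [map_sub]; congr 1; abel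
      _ ≤ ‖U t a - U t₀ v‖ + ‖U t (a - v)‖ := norm_sub_le _ _
      _ ≤ _ := by rw [(U t).norm_map]; linarith
  have hlim : Tendsto (fun t => 2 * ‖WithLp.toLp 2 ((0 : X), M t x - M t₀ x)‖) (𝓝[s] t₀)
      (𝓝 0) := by
    have hc : ContinuousWithinAt (fun t => 2 * ‖WithLp.toLp 2 ((0 : X), M t x - M t₀ x)‖)
        s t₀ := by
      have hMx : ContinuousWithinAt (fun t => M t x) s t₀ :=
        (hM t₀ ht₀).clm_apply continuousWithinAt_const
      refine continuousWithinAt_const.mul (ContinuousWithinAt.norm ?_)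
      exact (WithLp.prod_continuous_toLp 2 X Y).continuousAt.comp_continuousWithinAt
        (continuousWithinAt_const.prodMk (hMx.sub continuousWithinAt_const))
    have := hc.tendsto
    simpa using this
  rw [ContinuousWithinAt, tendsto_iff_norm_sub_tendsto_zero]
  refine squeeze_zero' (Eventually.of_forall fun t => norm_nonneg _) ?_ hlim
  filter_upwards [self_mem_nhdsWithin] with t ht
  exact hbound t ht

end GraphContinuity

/-! ### Existence of subdivisions for the spectral flow. -/

theorem exists_subdivision {a b c d : ℝ} (hab : a ≤ b) (Q : ℝ → ℝ → Prop)
    (hopen : ∀ ε, IsOpen {t : Icc a b | Q ε t})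
    (hex : ∀ t ∈ Icc a b, ∃ ε, c < ε ∧ ε < d ∧ Q ε t) :
    ∃ (m : ℕ) (s ε : ℕ → ℝ), Monotone s ∧ s 0 = a ∧ s m = b ∧
      ∀ i < m, c < ε i ∧ ε i < d ∧ ∀ t ∈ Icc (s i) (s (i + 1)), Q (ε i) t := by
  have hcover : univ ⊆ ⋃ ε : Ioo c d, {t : Icc a b | Q ε t} := by
    intro t _
    obtain ⟨ε, h₁, h₂, h₃⟩ := hex t t.2
    exact mem_iUnion.2 ⟨⟨ε, h₁, h₂⟩, h₃⟩
  obtain ⟨s, hs₀, hmono, ⟨m, hm⟩, hsub⟩ :=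
    exists_monotone_Icc_subset_open_cover_Icc hab (fun ε : Ioo c d => hopen ε) hcover
  choose ε hε using hsub
  refine ⟨m, fun i => s i, fun i => ε i, fun i j hij => hmono hij, by simp only [hs₀],
    by simp only [hm m le_rfl], fun i _ => ⟨(ε i).2.1, (ε i).2.2, fun t ht => ?_⟩⟩
  exact hε i (show (⟨t, (s i).2.1.trans ht.1, ht.2.trans (s (i + 1)).2.2⟩ : Icc a b) ∈
    Icc (s i) (s (i + 1)) from ht)

section Partition

variable {V : Type*} [NormedAddCommGroup V] [InnerProductSpace ℂ V] [FiniteDimensional ℂ V]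

theorem exists_angle_not_hasEigenvalue (f : V →ₗ[ℂ] V) :
    ∃ ε : ℝ, 0 < ε ∧ ε < Real.pi ∧ ¬ Module.End.HasEigenvalue f (Complex.exp (ε * Complex.I)) := by
  by_contra! h
  -- The open upper half circle is infinite, while an operator has finitely many eigenvalues.
  have hinj : InjOn (fun ε : ℝ => Complex.exp (ε * Complex.I)) (Ioo 0 Real.pi) := by
    intro x hx y hy hxy
    have hx' := Complex.arg_exp_mul_I x
    have hy' := Complex.arg_exp_mul_I y
    rw [(toIocMod_eq_self _).2 ⟨by linarith [hx.1, Real.pi_pos], by linarith [hx.2]⟩] at hx'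
    rw [(toIocMod_eq_self _).2 ⟨by linarith [hy.1, Real.pi_pos], by linarith [hy.2]⟩] at hy'
    rw [← hx', ← hy']
    exact congrArg Complex.arg hxy
  refine ((Ioo_infinite Real.pi_pos).image hinj) ((Module.End.finite_hasEigenvalue f).subset ?_)
  rintro _ ⟨ε, hε, rfl⟩
  exact h ε hε.1 hε.2

theorem hasEigenvalue_iff_det_eq_zero (f : V →L[ℂ] V) (μ : ℂ) :
    Module.End.HasEigenvalue (f : V →ₗ[ℂ] V) μ ↔ (μ • ContinuousLinearMap.id ℂ V - f).det = 0 := by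
  rw [Module.End.hasEigenvalue_iff_isRoot_charpoly, Polynomial.IsRoot, LinearMap.eval_charpoly]
  rfl

/-- A continuous curve of unitary operators admits a subdivision as in the definition of the
spectral flow. -/
theorem exists_partition {A : ℝ → (V ≃ₗᵢ[ℂ] V)} {a b : ℝ} (hab : a ≤ b)
    (hA : ContinuousOn (fun t => ((A t : V ≃L[ℂ] V) : V →L[ℂ] V)) (Icc a b)) :
    ∃ (m : ℕ) (s ε : ℕ → ℝ), Monotone s ∧ s 0 = a ∧ s m = b ∧
      ∀ i < m, 0 < ε i ∧ ε i < Real.pi ∧ ∀ t ∈ Icc (s i) (s (i + 1)),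
        ¬ Module.End.HasEigenvalue ((A t).toLinearEquiv : V →ₗ[ℂ] V)
          (Complex.exp (ε i * Complex.I)) := by
  refine exists_subdivision hab (fun ε t =>
    ¬ Module.End.HasEigenvalue ((A t).toLinearEquiv : V →ₗ[ℂ] V)
      (Complex.exp (ε * Complex.I))) (fun ε => ?_)
    (fun t _ => exists_angle_not_hasEigenvalue ((A t).toLinearEquiv : V →ₗ[ℂ] V))
  -- Avoiding a fixed eigenvalue is the nonvanishing of a determinant continuous in t, hence an open
  -- condition.
  have heq : {t : Icc a b | ¬ Module.End.HasEigenvalue ((A t).toLinearEquiv : V →ₗ[ℂ] V)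
      (Complex.exp (ε * Complex.I))} = {t : Icc a b | (Complex.exp (ε * Complex.I) •
      ContinuousLinearMap.id ℂ V - ((A t : V ≃L[ℂ] V) : V →L[ℂ] V)).det ≠ 0} := by
    ext t
    exact not_congr (hasEigenvalue_iff_det_eq_zero ((A t : V ≃L[ℂ] V) : V →L[ℂ] V) _)
  rw [heq]
  exact isOpen_ne_fun (ContinuousLinearMap.continuous_det.comp
    (continuous_const.sub (continuousOn_iff_continuous_domRestrict.1 hA))) continuous_const

theorem exists_hasMaslovIndex {J : V →L[ℂ] V} (hJ : IsCompatible J) {Λ Λ' : ℝ → Submodule ℂ V}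
    {a b : ℝ} (hab : a ≤ b) (U U' : ℝ → (plusSpace J ≃ₗᵢ[ℂ] minusSpace J))
    (hU : ContinuousOn (fun t => ((U t : plusSpace J ≃L[ℂ] minusSpace J) :
      plusSpace J →L[ℂ] minusSpace J)) (Icc a b))
    (hU' : ContinuousOn (fun t => ((U' t : plusSpace J ≃L[ℂ] minusSpace J) :
      plusSpace J →L[ℂ] minusSpace J)) (Icc a b))
    (hsymm : ContinuousOn (fun t => (((U' t).symm : minusSpace J ≃L[ℂ] plusSpace J) :
      minusSpace J →L[ℂ] plusSpace J)) (Icc a b))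
    (hΛ : ∀ t ∈ Icc a b, Λ t = isometryGraph J (U t) ∧ Λ' t = isometryGraph J (U' t)) :
    ∃ k, HasMaslovIndex J Λ Λ' a b k := by
  have hA : ContinuousOn (fun t => (((U t).trans (U' t).symm : plusSpace J ≃L[ℂ] plusSpace J) :
      plusSpace J →L[ℂ] plusSpace J)) (Icc a b) := hsymm.clm_comp hU
  obtain ⟨m, s, ε, hs, hs₀, hsm, hε⟩ := exists_partition hab hA
  exact ⟨_, hJ, U, U', hU, hU', hΛ, hA, m, s, ε, hs, hs₀, hsm, hε, neg_neg _⟩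

end Partition

/-! ### The path γ and the space W(R): existence and value of the index. -/

section Curves

variable {n : ℕ}

theorem isCompatible_stdDiff (n : ℕ) : IsCompatible (stdDiff n) := by
  constructor
  · intro x y
    rw [stdDiff_apply, stdDiff_apply]
    simp [WithLp.prod_inner_apply]
    ring
  · intro x
    rw [stdDiff_apply, stdDiff_apply]
    rfl

theorem omega_stdDiff (v w : WithLp 2 (C2n n × C2n n)) :
    omega (stdDiff n) v w =
      inner ℂ (halfCoord n w) (otherCoord n v) - inner ℂ (otherCoord n w) (halfCoord n v) := by
  rw [omega, stdDiff_apply]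
  simp [halfCoord, otherCoord, WithLp.prod_inner_apply]
  ring

theorem isotropic_WR (R : Submodule ℂ (C2n n)) :
    ∀ x ∈ WR R, ∀ y ∈ WR R, omega (stdDiff n) x y = 0 := by
  intro x hx y hy
  rw [mem_WR] at hx hy
  rw [omega_stdDiff, R.inner_left_of_mem_orthogonal hx.2 hy.1,
    R.inner_right_of_mem_orthogonal hy.2 hx.1, sub_zero]

theorem finrank_C4n :
    Module.finrank ℂ (WithLp 2 (C2n n × C2n n)) = (n + n) + (n + n) := by
  rw [LinearEquiv.finrank_eq (WithLp.linearEquiv 2 ℂ (C2n n × C2n n)), Module.finrank_prod,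
    finrank_C2n]

/-- The coordinates `((x, -z), (y, u))` identify `W(R)` with `Rᗮ ⊕ R`. -/
def equivWR (R : Submodule ℂ (C2n n)) : WR R ≃ₗ[ℂ] Rᗮ × R :=
  LinearEquiv.ofBijective
    (((halfCoord n ∘ₗ (WR R).subtype).codRestrict Rᗮ fun w => w.2.1).prod
      ((otherCoord n ∘ₗ (WR R).subtype).codRestrict R fun w => w.2.2)) <| by
    constructor
    · rw [← LinearMap.ker_eq_bot, LinearMap.ker_eq_bot']
      intro w hw
      have h₁ : halfCoord n w = 0 := congrArg (fun z => (z.1 : C2n n)) hw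
      have h₂ : otherCoord n w = 0 := congrArg (fun z => (z.2 : C2n n)) hw
      refine Subtype.ext ((inner_self_eq_zero (𝕜 := ℂ)).1 ?_)
      rw [inner_eq_coord, h₁, h₂, inner_zero_left, add_zero]
    · rintro ⟨r, q⟩
      let w : WithLp 2 (C2n n × C2n n) := WithLp.toLp 2
        (WithLp.toLp 2 ((r : C2n n).fst, (q : C2n n).fst),
          WithLp.toLp 2 (-(r : C2n n).snd, (q : C2n n).snd))
      have h₁ : halfCoord n w = r :=
        WithLp.ofLp_injective 2 (Prod.ext rfl (neg_neg (r : C2n n).snd))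
      have h₂ : otherCoord n w = q := rfl
      have hw : w ∈ WR R := mem_WR.2 ⟨h₁.symm ▸ r.2, h₂.symm ▸ q.2⟩
      exact ⟨⟨w, hw⟩, Prod.ext (Subtype.ext h₁) (Subtype.ext h₂)⟩

theorem finrank_WR (R : Submodule ℂ (C2n n)) : Module.finrank ℂ (WR R) = n + n := by
  have h := R.finrank_add_finrank_orthogonal
  rw [finrank_C2n] at h
  rw [(equivWR R).finrank_eq, Module.finrank_prod]
  omega

theorem isLagrange_WR (R : Submodule ℂ (C2n n)) : IsLagrange (stdDiff n) (WR R) :=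
  isLagrange_of_isotropic (isCompatible_stdDiff n) (isotropic_WR R)
    (by rw [finrank_WR, finrank_C4n])

theorem omega_diffStructure {X Y : Type*} [NormedAddCommGroup X] [InnerProductSpace ℂ X]
    [NormedAddCommGroup Y] [InnerProductSpace ℂ Y] (j₁ : X →L[ℂ] X) (j₂ : Y →L[ℂ] Y)
    (v w : WithLp 2 (X × Y)) :
    omega (diffStructure j₁ j₂) v w = omega j₂ v.snd w.snd - omega j₁ v.fst w.fst := by
  simp [omega, diffStructure, blockOp, WithLp.prod_inner_apply, inner_neg_right]
  ring

theorem isotropic_graph {X Y : Type*} [NormedAddCommGroup X] [InnerProductSpace ℂ X]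
    [NormedAddCommGroup Y] [InnerProductSpace ℂ Y] {j₁ : X →L[ℂ] X} {j₂ : Y →L[ℂ] Y}
    {M : X →L[ℂ] Y} (hM : IsSymplecticMap j₁ j₂ M) :
    ∀ x ∈ graph M, ∀ y ∈ graph M, omega (diffStructure j₁ j₂) x y = 0 := by
  intro x hx y hy
  have hx' : x.snd = M x.fst := hx
  have hy' : y.snd = M y.fst := hy
  rw [omega_diffStructure, hx', hy', hM, sub_self]

/-- The graph of `M` is isomorphic to the domain of `M`. -/
def graphEquiv {X Y : Type*} [NormedAddCommGroup X] [InnerProductSpace ℂ X]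
    [NormedAddCommGroup Y] [InnerProductSpace ℂ Y] (M : X →L[ℂ] Y) : graph M ≃ₗ[ℂ] X :=
  LinearEquiv.ofBijective (WithLp.fstₗ 2 ℂ X Y ∘ₗ (graph M).subtype) <| by
    constructor
    · intro v w h
      have h' : (v : WithLp 2 (X × Y)).fst = (w : WithLp 2 (X × Y)).fst := h
      have hv : (v : WithLp 2 (X × Y)).snd = M (v : WithLp 2 (X × Y)).fst := v.2
      have hw : (w : WithLp 2 (X × Y)).snd = M (w : WithLp 2 (X × Y)).fst := w.2
      exact Subtype.ext (WithLp.ofLp_injective 2 (Prod.ext h' (by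
        show (v : WithLp 2 (X × Y)).snd = (w : WithLp 2 (X × Y)).snd
        rw [hv, hw, h'])))
    · intro x
      exact ⟨⟨WithLp.toLp 2 (x, M x), rfl⟩, rfl⟩

theorem isSymmetric_toEuclideanCLM {A : Matrix (Fin n) (Fin n) ℂ} (hA : A.IsHermitian) :
    ((Matrix.toEuclideanCLM (𝕜 := ℂ) A : Cn n →L[ℂ] Cn n) : Cn n →ₗ[ℂ] Cn n).IsSymmetric :=
  Matrix.isSymmetric_toEuclideanLin_iff.2 hA

theorem continuous_toEuclideanCLM :
    Continuous fun A : Matrix (Fin n) (Fin n) ℂ => Matrix.toEuclideanCLM (𝕜 := ℂ) A :=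
  (Matrix.toEuclideanCLM (n := Fin n) (𝕜 := ℂ)).toAlgEquiv.toLinearMap.continuous_of_finiteDimensional

variable {P : ℝ → Matrix (Fin n) (Fin n) ℂ}

theorem isSymplecticMap_shearPath {t : ℝ} (hP : (P t).IsHermitian) :
    IsSymplecticMap (stdJ n) (stdJ n) (shearPath P t) := by
  intro x y
  have h : inner ℂ (Matrix.toEuclideanCLM (𝕜 := ℂ) (P t) y.fst) x.fst =
    inner ℂ y.fst (Matrix.toEuclideanCLM (𝕜 := ℂ) (P t) x.fst) :=
    isSymmetric_toEuclideanCLM hP y.fst x.fst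
  simp [omega, shearPath_apply, stdJ_apply, WithLp.prod_inner_apply, inner_add_left,
    inner_add_right, h]

theorem continuousOn_shearPath {s : Set ℝ} (hP : ContinuousOn P s) :
    ContinuousOn (shearPath P) s := by
  rw [continuousOn_clm_apply]
  intro v
  simp only [shearPath_apply]
  refine (WithLp.prod_continuous_toLp 2 _ _).comp_continuousOn
    (continuousOn_const.prodMk (ContinuousOn.add ?_ continuousOn_const))
  exact (continuous_toEuclideanCLM.comp_continuousOn hP).clm_apply continuousOn_const

theorem exists_hasMaslovTypeIndex {a b : ℝ} (hab : a ≤ b) (R : Submodule ℂ (C2n n))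
    (hPc : ContinuousOn P (Icc a b)) (hP : ∀ t ∈ Icc a b, (P t).IsHermitian) :
    ∃ k, HasMaslovTypeIndex (stdJ n) (stdJ n) (WR R) (shearPath P) a b k := by
  have hJ := isCompatible_stdDiff n
  obtain ⟨U', hU'⟩ := exists_eq_isometryGraph hJ (isotropic_WR R) (by rw [finrank_WR, finrank_C4n])
  have hex : ∀ t, ∃ U : plusSpace (stdDiff n) ≃ₗᵢ[ℂ] minusSpace (stdDiff n),
      t ∈ Icc a b → graph (shearPath P t) = isometryGraph (stdDiff n) U := by
    intro t
    by_cases ht : t ∈ Icc a b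
    · obtain ⟨U, hU⟩ := exists_eq_isometryGraph hJ
        (isotropic_graph (isSymplecticMap_shearPath (hP t ht)))
        (by rw [(graphEquiv _).finrank_eq, finrank_C4n, finrank_C2n])
      exact ⟨U, fun _ => hU⟩
    -- Any isometry serves outside the interval; U' is one at hand.
    · exact ⟨U', fun h => absurd h ht⟩
  choose U hU using hex
  obtain ⟨k, hk⟩ := exists_hasMaslovIndex hJ (Λ := fun t => graph (shearPath P t))
    (Λ' := fun _ => WR R) hab U (fun _ => U')
    (continuousOn_of_graph hJ (continuousOn_shearPath hPc) hU) continuousOn_const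
    continuousOn_const fun t ht => ⟨hU t ht, hU'⟩
  exact ⟨k, isLagrange_WR R, continuousOn_shearPath hPc,
    fun t ht => isSymplecticMap_shearPath (hP t ht), hk⟩

theorem upperCount_add_morsePosOn_eq {a b ε : ℝ} (hab : a ≤ b) (h0 : 0 < ε) (hπ : ε < Real.pi)
    {R : Submodule ℂ (C2n n)} (hPc : ContinuousOn P (Icc a b))
    (hP : ∀ t ∈ Icc a b, (P t).IsHermitian)
    {U U' : ℝ → (plusSpace (stdDiff n) ≃ₗᵢ[ℂ] minusSpace (stdDiff n))}
    (hU : ∀ t ∈ Icc a b, graph (shearPath P t) = isometryGraph (stdDiff n) (U t) ∧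
      WR R = isometryGraph (stdDiff n) (U' t))
    (hA : ∀ t ∈ Icc a b, ¬ Module.End.HasEigenvalue (((U t).trans (U' t).symm).toLinearEquiv :
      plusSpace (stdDiff n) →ₗ[ℂ] plusSpace (stdDiff n)) (Complex.exp (ε * Complex.I))) :
    upperCount ((U a).trans (U' a).symm) ε + morsePosOn (P a) (diagSpace R) =
      upperCount ((U b).trans (U' b).symm) ε + morsePosOn (P b) (diagSpace R) :=
  eq_of_definite_subspaces R (τ := Real.sin (ε / 2) / Real.cos (ε / 2))
    (P := fun t => Matrix.toEuclideanCLM (𝕜 := ℂ) (P t))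
    (continuous_toEuclideanCLM.comp_continuousOn hPc)
    (F := fun t => upperCount ((U t).trans (U' t).symm) ε + morsePosOn (P t) (diagSpace R))
    (fun t ht => exists_definite_of_unitary (isSymmetric_toEuclideanCLM (hP t ht))
      (shearPath_apply P t) (U t) (U' t) (hU t ht).1 (hU t ht).2 h0 hπ (hA t ht)) hab

/-- Nothing is assumed about how k was obtained, so this yields both the value of the index and its
independence of the subdivision, the angles and the isometries. -/
theorem hasMaslovTypeIndex_eq {a b : ℝ} {R : Submodule ℂ (C2n n)}
    (hPc : ContinuousOn P (Icc a b)) (hP : ∀ t ∈ Icc a b, (P t).IsHermitian) {k : ℤ}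
    (hk : HasMaslovTypeIndex (stdJ n) (stdJ n) (WR R) (shearPath P) a b k) :
    k = (morsePosOn (P b) (diagSpace R) : ℤ) - (morsePosOn (P a) (diagSpace R) : ℤ) := by
  obtain ⟨-, -, -, -, U, U', -, -, hU, -, m, s, ε, hs, rfl, rfl, hε, hsum⟩ := hk
  have hterm : ∀ i ∈ Finset.range m,
      ((upperCount ((U (s (i + 1))).trans (U' (s (i + 1))).symm) (ε i) : ℤ) -
        (upperCount ((U (s i)).trans (U' (s i)).symm) (ε i) : ℤ)) =
      -(morsePosOn (P (s (i + 1))) (diagSpace R) : ℤ) -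
        -(morsePosOn (P (s i)) (diagSpace R) : ℤ) := by
    intro i hi
    have hi' := Finset.mem_range.1 hi
    obtain ⟨h0, hπ, hA⟩ := hε i hi'
    have hsub : Icc (s i) (s (i + 1)) ⊆ Icc (s 0) (s m) :=
      Icc_subset_Icc (hs (Nat.zero_le i)) (hs hi')
    have := upperCount_add_morsePosOn_eq (hs i.le_succ : s i ≤ s (i + 1)) h0 hπ (hPc.mono hsub)
      (fun t ht => hP t (hsub ht)) (fun t ht => hU t (hsub ht)) hA
    omega
  rw [Finset.sum_congr rfl hterm,
    Finset.sum_range_sub (fun i => -(morsePosOn (P (s i)) (diagSpace R) : ℤ))] at hsum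
  linarith

end Curves

end MaslovIndex
end

theorem theorem1p2 (n : ℕ) (T : ℝ) (hT : 0 < T)
    (R : Submodule ℂ (MaslovIndex.C2n n))
    (P : ℝ → Matrix (Fin n) (Fin n) ℂ)
    (hPcont : ContinuousOn P (Set.Icc 0 T))
    (hPsa : ∀ t ∈ Set.Icc (0 : ℝ) T, (P t).IsHermitian) :
    (∃! k : ℤ, MaslovIndex.HasMaslovTypeIndex (MaslovIndex.stdJ n) (MaslovIndex.stdJ n)
      (MaslovIndex.WR R) (MaslovIndex.shearPath P) 0 T k) ∧
    MaslovIndex.maslovTypeIndex (MaslovIndex.stdJ n) (MaslovIndex.stdJ n)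
      (MaslovIndex.WR R) (MaslovIndex.shearPath P) 0 T =
      (MaslovIndex.morsePosOn (P T) (MaslovIndex.diagSpace R) : ℤ) -
        (MaslovIndex.morsePosOn (P 0) (MaslovIndex.diagSpace R) : ℤ) := by
  have hex := MaslovIndex.exists_hasMaslovTypeIndex hT.le R hPcont hPsa
  -- Existence makes the integer chosen by `Classical.epsilon` a genuine index, so the general
  -- formula applies to it.
  refine ⟨?_, MaslovIndex.hasMaslovTypeIndex_eq hPcont hPsa (Classical.epsilon_spec hex)⟩
  obtain ⟨k, hk⟩ := hex
  exact ⟨k, hk, fun l hl => (MaslovIndex.hasMaslovTypeIndex_eq hPcont hPsa hl).trans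
    (MaslovIndex.hasMaslovTypeIndex_eq hPcont hPsa hk).symm⟩
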